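/- Let $n\ge 0$ and let $\mathcal J^2=\mathbb R\times\mathbb R^n\times\mathcal S(n)$ be the space of 2-jets $(r,p,A)$, where $\mathcal S(n)$ denotes the symmetric real $n\times n$ matrices. A *subequation* is a set $\mathcal F\subset\mathcal J^2$ with $\mathcal F\neq\emptyset$, $\mathcal F\ne\mathcal J^2$, such that (P) $(r,p,A)\in\mathcal F$ and $P\ge 0$ imply $(r,p,A+P)\in\mathcal F$; (N) $(r,p,A)\in\mathcal F$ and $s\le 0$ imply $(r+s,p,A)\in\mathcal F$; (T) $\mathcal F=\overline{\operatorname{Int}\mathcal F}$. A *monotonicity cone subequation* is a closed convex cone $\mathcal M\subset\mathcal J^2$ with vertex at the origin which contains $(-\infty,0]\times\{0\}\times\{P\in\mathcal S(n):P\ge0\}$ and satisfies $\mathcal M=\overline{\operatorname{Int}\mathcal M}$; it is a monotonicity cone subequation *for* $\mathcal F$ if moreover $\mathcal F+\mathcal M\subset\mathcal F$. Let $\mathcal F$ be a subequation and $\mathcal M$ a monotonicity cone subequation for $\mathcal F$. Let $\Omega\subset\mathbb R^n$ be a bounded open set (for instance a bounded domain) on which $\mathcal M$ admits a strict approximator,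 that is, there is $\psi\in C(\overline\Omega)\cap C^2(\Omega)$ with $(\psi(x),D\psi(x),D^2\psi(x))\in\operatorname{Int}\mathcal M$ for every $x\in\Omega$. Fix $J_0\in\operatorname{Int}\mathcal M$ and let $F:\mathcal J^2\to\mathbb R$ be the canonical operator for $\mathcal F$ determined by $J_0$: $F(J)=-t_J$, where $\{t\in\mathbb R: J+tJ_0\in\mathcal F\}=[t_J,+\infty)$ (equivalently, $t_J$ is the unique real number with $J+t_JJ_0\in\partial\mathcal F$). Then for every $c\in\mathbb R$ the comparison principle holds for the equation $F(u,Du,D^2u)=c$ on $\Omega$: if $u:\overline\Omega\to[-\infty,+\infty)$ is upper semicontinuous, $w:\overline\Omega\to(-\infty,+\infty]$ is lower semicontinuous, $u$ is a viscosity subsolution and $w$ is a viscosity supersolution of $F(u,Du,D^2u)=c$ on $\Omega$, and $u\le w$ on $\partial\Omega$, then $u\le w$ on $\Omega$. Here $u$ is a viscosity subsolution if for all $x_0\in\Omega$ and all $\varphi$ of class $C^2$ near $x_0$ with $u\le\varphi$ near $x_0$ and $u(x_0)=\varphi(x_0)$ one has $F(\varphi(x_0),D\varphi(x_0),D^2\varphi(x_0))\ge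 c$; and $w$ is a viscosity supersolution if for all $x_0\in\Omega$ and all $\varphi$ of class $C^2$ near $x_0$ with $w\ge\varphi$ near $x_0$ and $w(x_0)=\varphi(x_0)$ one has $F(\varphi(x_0),D\varphi(x_0),D^2\varphi(x_0))\le c$. -/

import Mathlib

open Set Filter Topology

/-- The space of symmetric real `n × n` matrices. -/
def SymMat (n : ℕ) : Submodule ℝ (Matrix (Fin n) (Fin n) ℝ) where
  carrier := {A | A.IsSymm}
  add_mem' := fun ha hb => Matrix.IsSymm.add ha hb
  zero_mem' := Matrix.isSymm_zero
  smul_mem' := fun c _ ha => Matrix.IsSymm.smul ha c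

/-- The space of 2-jets `ℝ × ℝⁿ × Sym(n)` with coordinates `(r, p, A)` (product topology). -/
abbrev Jet2 (n : ℕ) : Type := ℝ × EuclideanSpace ℝ (Fin n) × SymMat n

/-- A (constant coefficient) subequation constraint set: a nonempty proper subset of the space of
2-jets satisfying positivity (P), negativity (N) and the topological condition (T). -/
structure IsSubequation {n : ℕ} (F : Set (Jet2 n)) : Prop where
  nonempty : F.Nonempty
  ne_univ : F ≠ univ
  positivity : ∀ (r : ℝ) (p : EuclideanSpace ℝ (Fin n)) (A P : SymMat n),
    (r, p, A) ∈ F → (P : Matrix (Fin n) (Fin n) ℝ).PosSemidef → (r, p, A + P) ∈ F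
  negativity : ∀ (r s : ℝ) (p : EuclideanSpace ℝ (Fin n)) (A : SymMat n),
    (r, p, A) ∈ F → s ≤ 0 → (r + s, p, A) ∈ F
  topological : F = closure (interior F)

/-- A monotonicity cone subequation: a closed convex cone with vertex at the origin that contains
the minimal monotonicity set `(-∞, 0] × {0} × {P ≥ 0}` and satisfies (T). -/
structure IsMonotonicityConeSubequation {n : ℕ} (M : Set (Jet2 n)) : Prop where
  isClosed : IsClosed M
  convex : Convex ℝ M
  cone : ∀ t : ℝ, 0 ≤ t → ∀ J ∈ M, t • J ∈ M
  minimal_subset : ∀ (s : ℝ) (P : SymMat n),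
    s ≤ 0 → (P : Matrix (Fin n) (Fin n) ℝ).PosSemidef → (s, 0, P) ∈ M
  topological : M = closure (interior M)

/-- `F` is `M`-monotone: `F + M ⊆ F`. -/
def IsMonotoneFor {n : ℕ} (F M : Set (Jet2 n)) : Prop :=
  ∀ J ∈ F, ∀ K ∈ M, J + K ∈ F

/-- `J = (φ(x), Dφ(x), D²φ(x))` is the 2-jet of `φ` at `x`. It is used for functions that
are `C²` near `x`; these have a symmetric Hessian, hence exactly one 2-jet at `x`. -/
def IsJetAt {n : ℕ} (φ : EuclideanSpace ℝ (Fin n) → ℝ) (x : EuclideanSpace ℝ (Fin n))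
    (J : Jet2 n) : Prop :=
  J.1 = φ x ∧ J.2.1 = gradient φ x ∧
    ∀ i j : Fin n, (J.2.2 : Matrix (Fin n) (Fin n) ℝ) i j =
      fderiv ℝ (fderiv ℝ φ) x (EuclideanSpace.single i 1) (EuclideanSpace.single j 1)

/-- `M` admits a strict approximator on `Ω`: there is `ψ ∈ C(closure Ω) ∩ C²(Ω)` whose 2-jet at
each point of `Ω` lies in the interior of `M`. -/
def AdmitsStrictApproximator {n : ℕ} (M : Set (Jet2 n))
    (Ω : Set (EuclideanSpace ℝ (Fin n))) : Prop :=
  ∃ ψ : EuclideanSpace ℝ (Fin n) → ℝ, ContinuousOn ψ (closure Ω) ∧ ContDiffOn ℝ 2 ψ Ω ∧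
    ∀ x ∈ Ω, ∃ J ∈ interior M, IsJetAt ψ x J

/-- The canonical operator for `F` determined by `J₀`: `J ↦ -t_J`, where `t_J` is the left endpoint
of `{t | J + t J₀ ∈ F}`. -/
noncomputable def canonicalOperator {n : ℕ} (F : Set (Jet2 n)) (J₀ : Jet2 n) (J : Jet2 n) : ℝ :=
  -sInf {t : ℝ | J + t • J₀ ∈ F}

/-- Upper semicontinuous functions on `X` with values in `[-∞, ∞)`. -/
def USC {n : ℕ} (X : Set (EuclideanSpace ℝ (Fin n)))
    (u : EuclideanSpace ℝ (Fin n) → EReal) : Prop :=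
  UpperSemicontinuousOn u X ∧ ∀ x ∈ X, u x ≠ ⊤

/-- Lower semicontinuous functions on `X` with values in `(-∞, ∞]`. -/
def LSC {n : ℕ} (X : Set (EuclideanSpace ℝ (Fin n)))
    (w : EuclideanSpace ℝ (Fin n) → EReal) : Prop :=
  LowerSemicontinuousOn w X ∧ ∀ x ∈ X, w x ≠ ⊥

/-- The 2-jets at `x₀` of the `C²` upper test functions for `u` at `x₀`. -/
def upperTestJets {n : ℕ} (u : EuclideanSpace ℝ (Fin n) → EReal)
    (x₀ : EuclideanSpace ℝ (Fin n)) : Set (Jet2 n) :=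
  {J | ∃ φ : EuclideanSpace ℝ (Fin n) → ℝ, ContDiffAt ℝ 2 φ x₀ ∧
    (∀ᶠ x in 𝓝 x₀, u x ≤ (φ x : EReal)) ∧ u x₀ = (φ x₀ : EReal) ∧ IsJetAt φ x₀ J}

/-- The 2-jets at `x₀` of the `C²` lower test functions for `w` at `x₀`. -/
def lowerTestJets {n : ℕ} (w : EuclideanSpace ℝ (Fin n) → EReal)
    (x₀ : EuclideanSpace ℝ (Fin n)) : Set (Jet2 n) :=
  {J | ∃ φ : EuclideanSpace ℝ (Fin n) → ℝ, ContDiffAt ℝ 2 φ x₀ ∧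
    (∀ᶠ x in 𝓝 x₀, (φ x : EReal) ≤ w x) ∧ w x₀ = (φ x₀ : EReal) ∧ IsJetAt φ x₀ J}

/-- `u` is a (standard) viscosity subsolution of `G(u, Du, D²u) = c` on the open set `Ω`. -/
def IsViscositySubsolution {n : ℕ} (G : Jet2 n → ℝ) (c : ℝ)
    (Ω : Set (EuclideanSpace ℝ (Fin n))) (u : EuclideanSpace ℝ (Fin n) → EReal) : Prop :=
  USC Ω u ∧ ∀ x₀ ∈ Ω, ∀ J ∈ upperTestJets u x₀, c ≤ G J

/-- `w` is a (standard) viscosity supersolution of `G(w, Dw, D²w) = c` on the open set `Ω`. -/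
def IsViscositySupersolution {n : ℕ} (G : Jet2 n → ℝ) (c : ℝ)
    (Ω : Set (EuclideanSpace ℝ (Fin n))) (w : EuclideanSpace ℝ (Fin n) → EReal) : Prop :=
  LSC Ω w ∧ ∀ x₀ ∈ Ω, ∀ J ∈ lowerTestJets w x₀, G J ≤ c

/-- If `J₀` is in the interior of the cone `M`, then `J + t J₀ ∈ M` for some `t > 0`. -/
theorem exists_add_smul_mem {n : ℕ} {M : Set (Jet2 n)} (hM : IsMonotonicityConeSubequation M)
    {J₀ : Jet2 n} (hJ₀ : J₀ ∈ interior M) (J : Jet2 n) : ∃ t : ℝ, 0 < t ∧ J + t • J₀ ∈ M := by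
  have hc : Continuous fun s : ℝ => s • J + J₀ := by fun_prop
  have h0 : (fun s : ℝ => s • J + J₀) ⁻¹' interior M ∈ 𝓝 (0 : ℝ) :=
    (isOpen_interior.preimage hc).mem_nhds (by simpa using hJ₀)
  have h1 : ∀ᶠ s in 𝓝[>] (0 : ℝ), s • J + J₀ ∈ interior M := nhdsWithin_le_nhds h0
  obtain ⟨s, hs, hs0⟩ := (h1.and self_mem_nhdsWithin).exists
  have hs0 : 0 < s := hs0
  refine ⟨s⁻¹, inv_pos.2 hs0, ?_⟩
  have := hM.cone s⁻¹ (inv_pos.2 hs0).le _ (interior_subset hs)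
  rwa [smul_add, smul_smul, inv_mul_cancel₀ hs0.ne', one_smul] at this

/-- The canonical operator is well defined: `{t | J + t J₀ ∈ F}` is the closed half-line
`[t_J, ∞)` with `t_J` the negative of the value of the operator. -/
theorem canonicalOperator_halfLine {n : ℕ} {F M : Set (Jet2 n)} (hF : IsSubequation F)
    (hM : IsMonotonicityConeSubequation M) (hFM : IsMonotoneFor F M) {J₀ : Jet2 n}
    (hJ₀ : J₀ ∈ interior M) (J : Jet2 n) :
    {t : ℝ | J + t • J₀ ∈ F} = Ici (-canonicalOperator F J₀ J) := by
  have hcl : IsClosed F := by rw [hF.topological]; exact isClosed_closure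
  have up : ∀ K : Jet2 n, K ∈ F → ∀ s : ℝ, 0 ≤ s → K + s • J₀ ∈ F := fun K hK s hs =>
    hFM _ hK _ (hM.cone s hs _ (interior_subset hJ₀))
  have hmono : ∀ t ∈ {t : ℝ | J + t • J₀ ∈ F}, ∀ t', t ≤ t' → t' ∈ {t : ℝ | J + t • J₀ ∈ F} := by
    intro t ht t' htt'
    have := up _ ht (t' - t) (sub_nonneg.2 htt')
    rwa [add_assoc, ← add_smul, add_sub_cancel] at this
  have hne : {t : ℝ | J + t • J₀ ∈ F}.Nonempty := by
    obtain ⟨J₁, hJ₁⟩ := hF.nonempty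
    obtain ⟨t, _, ht⟩ := exists_add_smul_mem hM hJ₀ (J - J₁)
    refine ⟨t, ?_⟩
    have := hFM _ hJ₁ _ ht
    rwa [← add_assoc, add_sub_cancel] at this
  have hbdd : BddBelow {t : ℝ | J + t • J₀ ∈ F} := by
    obtain ⟨J', hJ'⟩ := (ne_univ_iff_exists_notMem F).1 hF.ne_univ
    obtain ⟨s, _, hs⟩ := exists_add_smul_mem hM hJ₀ (J' - J)
    refine ⟨-s, fun t ht => ?_⟩
    by_contra hlt
    have h1 : J + (-s) • J₀ ∈ F := hmono t ht _ (not_le.1 hlt).le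
    have h2 := hFM _ h1 _ hs
    apply hJ'
    have h3 : (-s) • J₀ = -(s • J₀) := neg_smul s J₀
    have h4 : J + (-s) • J₀ + (J' - J + s • J₀) = J' := by rw [h3]; abel
    rwa [h4] at h2
  have hclosed : IsClosed {t : ℝ | J + t • J₀ ∈ F} :=
    hcl.preimage (f := fun t : ℝ => J + t • J₀) (by fun_prop)
  have hmin := hclosed.csInf_mem hne hbdd
  ext t
  simp only [canonicalOperator, neg_neg, mem_Ici]
  exact ⟨fun ht => csInf_le hbdd ht, fun ht => hmono _ hmin _ ht⟩

/-- `t = -canonicalOperator F J₀ J` is the unique real number with `J + t J₀ ∈ ∂F`. -/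
theorem canonicalOperator_frontier {n : ℕ} {F M : Set (Jet2 n)} (hF : IsSubequation F)
    (hM : IsMonotonicityConeSubequation M) (hFM : IsMonotoneFor F M) {J₀ : Jet2 n}
    (hJ₀ : J₀ ∈ interior M) (J : Jet2 n) (t : ℝ) :
    J + t • J₀ ∈ frontier F ↔ t = -canonicalOperator F J₀ J := by
  have hcl : IsClosed F := by rw [hF.topological]; exact isClosed_closure
  have key : ∀ t : ℝ, J + t • J₀ ∈ F ↔ -canonicalOperator F J₀ J ≤ t := fun t => by
    have := canonicalOperator_halfLine hF hM hFM hJ₀ J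
    exact Set.ext_iff.1 this t
  have hint : ∀ K ∈ F, ∀ s : ℝ, 0 < s → K + s • J₀ ∈ interior F := by
    intro K hK s hs
    have hc : Continuous fun L : Jet2 n => s⁻¹ • (L - K) := by fun_prop
    refine mem_interior.2 ⟨(fun L : Jet2 n => s⁻¹ • (L - K)) ⁻¹' interior M, fun L hL => ?_,
      isOpen_interior.preimage hc, ?_⟩
    · have h := hFM _ hK _ (hM.cone s hs.le _ (interior_subset hL))
      rwa [smul_smul, mul_inv_cancel₀ hs.ne', one_smul, add_sub_cancel] at h
    · simpa [smul_smul, inv_mul_cancel₀ hs.ne'] using hJ₀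
  rw [hcl.frontier_eq, Set.mem_sdiff, key]
  constructor
  · rintro ⟨h1, h2⟩
    by_contra hne
    have hlt : -canonicalOperator F J₀ J < t := lt_of_le_of_ne h1 (Ne.symm hne)
    apply h2
    have := hint _ ((key _).2 le_rfl) (t - -canonicalOperator F J₀ J) (sub_pos.2 hlt)
    rwa [add_assoc, ← add_smul, add_sub_cancel] at this
  · rintro rfl
    refine ⟨le_rfl, fun h => ?_⟩
    have hc : Continuous fun s : ℝ => J + s • J₀ := by fun_prop
    have h0 := (isOpen_interior.preimage hc).mem_nhds h
    have h1 : ∀ᶠ s in 𝓝[<] (-canonicalOperator F J₀ J), J + s • J₀ ∈ interior F :=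
      nhdsWithin_le_nhds h0
    obtain ⟨s, hs, hs0⟩ := (h1.and self_mem_nhdsWithin).exists
    exact absurd ((key s).1 (interior_subset hs)) (not_le.2 hs0)

/-! If `u > w` somewhere, maximize `u - w + εψ` over the closure of `Ω`. For small `ε` the maximum
is interior, at some `x₀`, with `m = u x₀ - w x₀`. There `u - w` is touched from above by `m + ε(ψ
x₀ - ψ)`, and since `-m ≤ ε ψ x₀` the negative of the touching jet still lies in `interior M`.
Trading a little Hessian turns this into strict touching by a quadratic `Q`
(`not_touching_neg_approximator`).

To exclude strict touching (`not_strict_touching_quadPoly`), replace `u` and `-w` by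
sup-convolutions `U` and `V`. A Jensen-type argument (`exists_contact_point`) finds a point where
both have second order expansions, where the slopes sum to nearly the slope of `Q`, and where the
Hessians sum to at most that of `Q`. These expansions move to test jets `J₁` of `u` and `-J₂` of
`w`, at possibly different points; constant coefficients make the jets comparable anyway. Their
difference `-J₂ - J₁` is a small perturbation of `-(jet of Q)` plus an element of the minimal cone,
hence lies in `interior M`. The canonical operator increases strictly in those directions
(`canonicalOperator_lt_add`), whereas the two viscosity inequalities give `F(-J₂) ≤ c ≤ F(J₁)`.

Alexandrov's theorem is not invoked. On the set of contact points the slopes are Lipschitz, so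
Rademacher's theorem differentiates them there, and at density points this already yields an
expansion in full neighbourhoods. -/

open Metric MeasureTheory Module
open scoped RealInnerProductSpace NNReal Pointwise Matrix

/-! ### Second order expansions from quadratic contact on a set. -/

section Contact

variable {E : Type*} [NormedAddCommGroup E] [InnerProductSpace ℝ E]

/-- A function `f` has at the points of `S` two-sided quadratic contact with constant `C` over `K`
with the affine functions of slope `G`. -/
def HasQuadraticContact (f : E → ℝ) (G : E → E) (C : ℝ) (S K : Set E) : Prop :=
  ∀ x ∈ S, ∀ y ∈ K, |f y - f x - ⟪G x, y - x⟫| ≤ C * ‖y - x‖ ^ 2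

/-- Comparing the affine approximations at `x` and `x'` at the common points `x` and `x + e`, `‖e‖ ≤
d`, costs `C d² + C (2d)² + C d²`; then take `e` along `G x - G x'`. The radius `3r` makes room for
`x + e`, since `d ≤ 2r`. -/
theorem HasQuadraticContact.lipschitzOnWith {f : E → ℝ} {G : E → E} {C r : ℝ} (hC : 0 ≤ C)
    {S : Set E} {x₀ : E} (hS : S ⊆ closedBall x₀ r)
    (h : HasQuadraticContact f G C S (closedBall x₀ (3 * r))) :
    LipschitzOnWith (6 * C).toNNReal G S := by
  refine LipschitzOnWith.of_dist_le_mul fun x hx x' hx' => ?_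
  rw [Real.coe_toNNReal _ (by positivity), dist_eq_norm, dist_eq_norm]
  have hxr : ‖x - x₀‖ ≤ r := by simpa [dist_eq_norm] using hS hx
  have hxr' : ‖x' - x₀‖ ≤ r := by simpa [dist_eq_norm] using hS hx'
  set d := ‖x - x'‖ with hd
  have hd2 : d ≤ 2 * r := by
    have := norm_sub_le (x - x₀) (x' - x₀)
    rw [sub_sub_sub_cancel_right] at this
    linarith
  have hd0 : 0 ≤ d := norm_nonneg _
  have key : ∀ e : E, ‖e‖ ≤ d → ⟪G x - G x', e⟫ ≤ 6 * C * d ^ 2 := by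
    intro e he
    have hy : x + e ∈ closedBall x₀ (3 * r) := by
      rw [mem_closedBall, dist_eq_norm]
      have := norm_add_le (x - x₀) e
      have h3 : x + e - x₀ = x - x₀ + e := by abel
      rw [h3]; linarith
    have hxm : x ∈ closedBall x₀ (3 * r) := by
      rw [mem_closedBall, dist_eq_norm]
      linarith [norm_nonneg (x - x₀)]
    have h1 := (abs_le.1 (h x hx _ hy)).2
    have h1' := (abs_le.1 (h x hx _ hy)).1
    have h2 := (abs_le.1 (h x' hx' _ hy)).2
    have h3 := (abs_le.1 (h x' hx' _ hxm)).1
    have e1 : x + e - x = e := by abel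
    have e2 : x + e - x' = (x - x') + e := by abel
    rw [e1] at h1 h1'
    rw [e2, inner_add_right] at h2
    have n1 : ‖e‖ ^ 2 ≤ d ^ 2 := by gcongr
    have n2 : ‖x - x' + e‖ ^ 2 ≤ (2 * d) ^ 2 := by
      gcongr
      exact (norm_add_le _ _).trans (by linarith)
    have n1' := mul_le_mul_of_nonneg_left n1 hC
    have n2' := mul_le_mul_of_nonneg_left n2 hC
    rw [inner_sub_left]
    linarith
  by_cases hv : G x - G x' = 0
  · rw [hv, norm_zero]; positivity
  have hv0 : 0 < ‖G x - G x'‖ := norm_pos_iff.2 hv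
  rcases hd0.eq_or_lt with hd' | hd'
  · exact absurd (by rw [sub_eq_zero.1 (norm_eq_zero.1 (hd'.symm : ‖x - x'‖ = 0)), sub_self]) hv
  have := key ((d / ‖G x - G x'‖) • (G x - G x')) (by
    rw [norm_smul, Real.norm_of_nonneg (by positivity), div_mul_cancel₀ _ hv0.ne'])
  rw [real_inner_smul_right, real_inner_self_eq_norm_sq] at this
  have h4 : d / ‖G x - G x'‖ * ‖G x - G x'‖ ^ 2 = d * ‖G x - G x'‖ := by field_simp
  rw [h4] at this
  exact le_of_mul_le_mul_left (by linarith [this]) hd'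

/-- The points of `S` come within `η r` of every point of the ball of radius `r` around `x`, for
all small `r`. -/
def IsThickAt (S : Set E) (x : E) : Prop :=
  ∀ η : ℝ, 0 < η → ∀ᶠ r in 𝓝[>] (0 : ℝ), ∀ y ∈ closedBall x r, ∃ z ∈ S, ‖y - z‖ ≤ η * r

/-- `f` has at `x` the second order Peano expansion with gradient `p` and Hessian `A`. -/
def HasPeanoExpansionAt (f : E → ℝ) (p : E) (A : E →L[ℝ] E) (x : E) : Prop :=
  ∀ ε : ℝ, 0 < ε → ∀ᶠ y in 𝓝 x,
    |f y - f x - ⟪p, y - x⟫ - 1 / 2 * ⟪A (y - x), y - x⟫| ≤ ε * ‖y - x‖ ^ 2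

/-- One link of a chain: a contact point `z` near `a` controls the increment of `f` from `b` to `a`,
and differentiability of `G` within `S` replaces `G z` by `G x + A (a - x)`. -/
theorem HasQuadraticContact.step_bound {f : E → ℝ} {G : E → E} {C r t : ℝ} (hC : 0 ≤ C)
    (hr : 0 < r) (ht : 0 < t) {S K : Set E} (h : HasQuadraticContact f G C S K) {A : E →L[ℝ] E}
    {x a b z e : E} (ha : a ∈ K) (hb : b ∈ K) (hz : z ∈ S) (haz : ‖a - z‖ ≤ t * r)
    (hab : a - b = t • e) (he : ‖e‖ = r)
    (hG : ‖G z - G x - A (z - x)‖ ≤ t * r) :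
    |f a - f b - ⟪G x, a - b⟫ - ⟪A (a - x), a - b⟫| ≤ (5 * C + 1 + ‖A‖) * (t * r) ^ 2 := by
  have hn : ‖a - b‖ = t * r := by rw [hab, norm_smul, he, Real.norm_of_nonneg ht.le]
  have h1 := h z hz a ha
  have h2 := h z hz b hb
  have n1 : ‖a - z‖ ^ 2 ≤ (t * r) ^ 2 := by gcongr
  have n2 : ‖b - z‖ ^ 2 ≤ (2 * (t * r)) ^ 2 := by
    gcongr
    have : b - z = (a - z) - (a - b) := by abel
    rw [this]
    exact (norm_sub_le _ _).trans (by linarith)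
  have n1' := mul_le_mul_of_nonneg_left n1 hC
  have n2' := mul_le_mul_of_nonneg_left n2 hC
  have h3 : |⟪G z - G x - A (z - x), a - b⟫| ≤ (t * r) * (t * r) := by
    refine (abs_real_inner_le_norm _ _).trans ?_
    rw [hn]; gcongr
  have h4 : |⟪A (a - z), a - b⟫| ≤ ‖A‖ * (t * r) * (t * r) := by
    refine (abs_real_inner_le_norm _ _).trans ?_
    rw [hn]
    gcongr
    exact (A.le_opNorm _).trans (by gcongr)
  have e1 : f a - f b - ⟪G x, a - b⟫ - ⟪A (a - x), a - b⟫
      = (f a - f z - ⟪G z, a - z⟫) - (f b - f z - ⟪G z, b - z⟫)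
        + ⟪G z - G x - A (z - x), a - b⟫ - ⟪A (a - z), a - b⟫ := by
    simp only [inner_sub_left, inner_sub_right, map_sub]
    ring
  rw [abs_le] at *
  constructor <;> nlinarith

/-- Cut the segment from `x` to `y` into `N` equal steps and sum the increments. Each step errs by
`O((r/N)²)`, so the total is `O(r²/N)`; thickness of `S` supplies a contact point near every node.
-/
theorem HasQuadraticContact.hasPeanoExpansionAt {f : E → ℝ} {G : E → E} {C : ℝ} (hC : 0 ≤ C)
    {S K : Set E} (h : HasQuadraticContact f G C S K) {x : E} (hK : K ∈ 𝓝 x)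
    {A : E →L[ℝ] E} (hA : HasFDerivWithinAt G A S x) (hS : IsThickAt S x) :
    HasPeanoExpansionAt f (G x) A x := by
  intro ε hε
  -- The second `‖A‖` pays for the gap `t²⟪A e, e⟫ / 2` between a right-endpoint Riemann sum and the
  -- exact quadratic.
  set κ := 5 * C + 1 + ‖A‖ + ‖A‖ with hκ
  have hκ0 : 0 < κ := by positivity
  obtain ⟨N, hN⟩ := exists_nat_gt (κ / ε)
  have hN0 : (0 : ℝ) < N := lt_of_le_of_lt (by positivity) hN
  set t : ℝ := 1 / N with ht
  have ht0 : 0 < t := by positivity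
  have htN : (N : ℝ) * t = 1 := by rw [ht]; field_simp
  have ht1 : t ≤ 1 := by
    have : (1 : ℝ) ≤ N := by exact_mod_cast Nat.one_le_iff_ne_zero.2 (by rintro rfl; simp at hN0)
    rw [ht, div_le_one hN0]; exact this
  obtain ⟨ρ, hρ, hρK⟩ := Metric.mem_nhds_iff.1 hK
  have hA' := (hasFDerivWithinAt_iff_isLittleO.1 hA).def (half_pos ht0)
  obtain ⟨ρ', hρ', hρA⟩ := Metric.mem_nhdsWithin_iff.1 hA'
  have hth := hS t ht0
  obtain ⟨ρ'', hρ'', hρS⟩ := mem_nhdsGT_iff_exists_Ioo_subset.1 hth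
  have hρ''0 : 0 < ρ'' := hρ''
  set σ := min (min ρ (ρ' / 2)) ρ'' with hσ
  have hσ0 : 0 < σ := by positivity
  filter_upwards [Metric.ball_mem_nhds x hσ0] with y hy
  rcases eq_or_ne y x with rfl | hyx
  · simp
  set e := y - x with he
  set r := ‖e‖ with hr
  have hr0 : 0 < r := norm_pos_iff.2 (sub_ne_zero.2 hyx)
  have hrσ : r < σ := by simpa [dist_eq_norm] using hy
  have hr1 : r < ρ := hrσ.trans_le ((min_le_left _ _).trans (min_le_left _ _))
  have hr2 : r < ρ' / 2 := hrσ.trans_le ((min_le_left _ _).trans (min_le_right _ _))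
  have hr3 : r < ρ'' := hrσ.trans_le (min_le_right _ _)
  have hthick : ∀ y ∈ closedBall x r, ∃ z ∈ S, ‖y - z‖ ≤ t * r := hρS ⟨hr0, hr3⟩
  have hGz : ∀ z ∈ S, ‖z - x‖ ≤ 2 * r → ‖G z - G x - A (z - x)‖ ≤ t * r := by
    intro z hz hzr
    have : z ∈ ball x ρ' ∩ S := ⟨by rw [mem_ball, dist_eq_norm]; linarith, hz⟩
    have h5 : ‖G z - G x - A (z - x)‖ ≤ t / 2 * ‖z - x‖ := hρA this
    nlinarith
  have claim : ∀ k : ℕ, k ≤ N →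
      |f (x + ((k : ℝ) * t) • e) - f x - ((k : ℝ) * t) * ⟪G x, e⟫
        - 1 / 2 * ((k : ℝ) * t) ^ 2 * ⟪A e, e⟫| ≤ k * (κ * (t * r) ^ 2) := by
    intro k
    induction k with
    | zero => intro _; simp
    | succ k ih =>
      intro hk
      have ih' := ih (by omega)
      have hin : ∀ j : ℕ, j ≤ N → ‖((j : ℝ) * t) • e‖ ≤ r := by
        intro j hj
        rw [norm_smul, Real.norm_of_nonneg (by positivity)]
        have : (j : ℝ) * t ≤ 1 := by
          rw [← htN]; gcongr
        nlinarith
      have hinK : ∀ j : ℕ, j ≤ N → x + ((j : ℝ) * t) • e ∈ K := fun j hj => by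
        apply hρK
        rw [mem_ball, dist_eq_norm, add_sub_cancel_left]
        exact (hin j hj).trans_lt hr1
      obtain ⟨z, hz, hza⟩ := hthick (x + (((k + 1 : ℕ) : ℝ) * t) • e) (by
        rw [mem_closedBall, dist_eq_norm, add_sub_cancel_left]
        exact hin _ hk)
      have hzx : ‖z - x‖ ≤ 2 * r := by
        have e3 : z - x = (((k + 1 : ℕ) : ℝ) * t) • e
            - (x + (((k + 1 : ℕ) : ℝ) * t) • e - z) := by abel
        rw [e3]
        refine (norm_sub_le _ _).trans ?_
        have := hin _ hk
        nlinarith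
      have hd : x + (((k + 1 : ℕ) : ℝ) * t) • e - (x + ((k : ℝ) * t) • e) = t • e := by
        rw [add_sub_add_left_eq_sub, ← sub_smul]; congr 1; push_cast; ring
      have hst := h.step_bound (x := x) (b := x + ((k : ℝ) * t) • e) hC hr0 ht0 (hinK _ hk)
        (hinK k (by omega)) hz hza hd rfl (hGz z hz hzx)
      rw [hd, add_sub_cancel_left] at hst
      simp only [map_smul, real_inner_smul_left, real_inner_smul_right] at hst
      have hAe : |⟪A e, e⟫| ≤ ‖A‖ * r ^ 2 := by
        refine (abs_real_inner_le_norm _ _).trans ?_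
        have := A.le_opNorm e
        rw [← hr] at this ⊢
        nlinarith
      have hAe' : |t ^ 2 * ⟪A e, e⟫| ≤ ‖A‖ * (t * r) ^ 2 := by
        rw [abs_mul, abs_of_nonneg (by positivity)]
        nlinarith [sq_nonneg t]
      rw [Nat.cast_succ] at hst ⊢
      have e4 : f (x + (((k : ℝ) + 1) * t) • e) - f x - (((k : ℝ) + 1) * t) * ⟪G x, e⟫
          - 1 / 2 * (((k : ℝ) + 1) * t) ^ 2 * ⟪A e, e⟫
          = (f (x + ((k : ℝ) * t) • e) - f x - ((k : ℝ) * t) * ⟪G x, e⟫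
            - 1 / 2 * ((k : ℝ) * t) ^ 2 * ⟪A e, e⟫)
          + (f (x + (((k : ℝ) + 1) * t) • e) - f (x + ((k : ℝ) * t) • e) - t * ⟪G x, e⟫
            - t * ((((k : ℝ) + 1) * t) * ⟪A e, e⟫)) + 1 / 2 * (t ^ 2 * ⟪A e, e⟫) := by ring
      rw [e4]
      refine (abs_add_le _ _).trans ((add_le_add (abs_add_le _ _) le_rfl).trans ?_)
      rw [abs_mul (1 / 2), abs_of_nonneg (by norm_num : (0 : ℝ) ≤ 1 / 2)]
      have h8 : κ * (t * r) ^ 2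
          = (5 * C + 1 + ‖A‖) * (t * r) ^ 2 + ‖A‖ * (t * r) ^ 2 := by rw [hκ]; ring
      have h9 : 0 ≤ |t ^ 2 * ⟪A e, e⟫| := abs_nonneg _
      linarith
  have hfin := claim N le_rfl
  rw [htN, one_smul, one_mul, one_pow, mul_one, he, add_sub_cancel, ← he] at hfin
  refine hfin.trans ?_
  have h6 : (N : ℝ) * (κ * (t * r) ^ 2) = κ * t * r ^ 2 * (N * t) := by ring
  rw [h6, htN, mul_one]
  have h7 : κ * t ≤ ε := by
    rw [div_lt_iff₀ hε] at hN
    rw [ht, mul_one_div, div_le_iff₀ hN0]; linarith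
  gcongr

/-- Cover the unit ball by finitely many balls of radius `η/2`; at a density point each of their
rescaled copies meets `S` once `r` is small. -/
theorem isThickAt_of_density_one [FiniteDimensional ℝ E] [MeasurableSpace E] [BorelSpace E]
    (μ : Measure E) [μ.IsAddHaarMeasure] (S : Set E) (x : E)
    (h : Tendsto (fun r => μ (S ∩ closedBall x r) / μ (closedBall x r)) (𝓝[>] 0) (𝓝 1)) :
    IsThickAt S x := by
  intro η hη
  obtain ⟨T, -, hTc⟩ := (isCompact_closedBall (0 : E) 1).elim_nhds_subcover
    (fun y => ball y (η / 2)) fun y _ => ball_mem_nhds y (by positivity)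
  have key : ∀ᶠ r in 𝓝[>] (0 : ℝ), ∀ y ∈ T, (S ∩ ({x} + r • ball y (η / 2))).Nonempty := by
    rw [Filter.eventually_all_finset]
    intro y _
    exact Measure.eventually_nonempty_inter_smul_of_density_one μ S x h _ measurableSet_ball
      (measure_ball_pos μ y (by positivity)).ne'
  filter_upwards [key, self_mem_nhdsWithin] with r hr hr0 y hy
  have hr0 : 0 < r := hr0
  have hy' : r⁻¹ • (y - x) ∈ closedBall (0 : E) 1 := by
    rw [mem_closedBall_zero_iff, norm_smul, norm_inv, Real.norm_of_nonneg hr0.le,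
      inv_mul_le_iff₀ hr0, mul_one, ← dist_eq_norm]
    exact hy
  obtain ⟨v, hvT, hv⟩ := mem_iUnion₂.1 (hTc hy')
  obtain ⟨z, hzS, hz⟩ := hr v hvT
  rw [singleton_add, mem_image] at hz
  obtain ⟨_, ⟨b, hb, rfl⟩, rfl⟩ := hz
  refine ⟨_, hzS, ?_⟩
  have e1 : y - (x + r • b) = r • ((r⁻¹ • (y - x) - v) - (b - v)) := by
    rw [sub_sub_sub_cancel_right, smul_sub, smul_smul, mul_inv_cancel₀ hr0.ne', one_smul]; abel
  show ‖y - (x + r • b)‖ ≤ η * r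
  rw [e1, norm_smul, Real.norm_of_nonneg hr0.le, mul_comm]
  rw [mem_ball, dist_eq_norm] at hv hb
  gcongr
  exact (norm_sub_le _ _).trans (by linarith)

end Contact

/-! ### A Jensen-type lemma for two semiconvex functions. -/

section Jensen

variable {E : Type*} [NormedAddCommGroup E] [InnerProductSpace ℝ E]

theorem eq_zero_of_inner_le_sq {v : E} {C : ℝ} (h : ∀ᶠ y in 𝓝 (0 : E), ⟪v, y⟫ ≤ C * ‖y‖ ^ 2) :
    v = 0 := by
  have hc : Tendsto (fun s : ℝ => s • v) (𝓝[>] 0) (𝓝 0) := by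
    have : Continuous fun s : ℝ => s • v := by fun_prop
    simpa using (this.tendsto 0).mono_left nhdsWithin_le_nhds
  have h2 : ∀ᶠ s in 𝓝[>] (0 : ℝ), s * |C| < 1 := by
    have : Continuous fun s : ℝ => s * |C| := by fun_prop
    have h3 := (this.tendsto 0).mono_left (nhdsWithin_le_nhds (s := Ioi 0))
    rw [zero_mul] at h3
    exact h3.eventually_lt_const one_pos
  obtain ⟨s, ⟨hs, hs2⟩, hs0⟩ := (((hc.eventually h).and h2).and self_mem_nhdsWithin).exists
  have hs0 : 0 < s := hs0
  rw [real_inner_smul_right, real_inner_self_eq_norm_sq, norm_smul,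
    Real.norm_of_nonneg hs0.le] at hs
  by_contra hv
  have hv0 : 0 < ‖v‖ ^ 2 := by positivity
  have h5 : s * ‖v‖ ^ 2 ≤ s * ((s * C) * ‖v‖ ^ 2) := by linarith [hs]
  have h6 := le_of_mul_le_mul_left h5 hs0
  have h7 : s * C ≤ s * |C| := by gcongr; exact le_abs_self C
  nlinarith

theorem HasPeanoExpansionAt.inner_nonpos_of_isLocalMax {Z : E → ℝ} {p : E} {A : E →L[ℝ] E} {x : E}
    (h : HasPeanoExpansionAt Z p A x) (hmax : ∀ᶠ y in 𝓝 x, Z y ≤ Z x + ⟪p, y - x⟫) (e : E) :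
    ⟪A e, e⟫ ≤ 0 := by
  have hc : Tendsto (fun s : ℝ => x + s • e) (𝓝[>] 0) (𝓝 x) := by
    have : Continuous fun s : ℝ => x + s • e := by fun_prop
    simpa using (this.tendsto 0).mono_left nhdsWithin_le_nhds
  refine le_of_forall_pos_le_add fun ε hε => ?_
  have hε' : 0 < ε / (2 * (‖e‖ ^ 2 + 1)) := by positivity
  obtain ⟨s, ⟨hs1, hs2⟩, hs0⟩ := ((hc.eventually ((h _ hε').and hmax)).and
    self_mem_nhdsWithin).exists
  have hs0 : 0 < s := hs0
  have h1 := (abs_le.1 hs1).1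
  rw [add_sub_cancel_left] at h1 hs2
  rw [map_smul, real_inner_smul_left, real_inner_smul_right (A e), norm_smul,
    Real.norm_of_nonneg hs0.le] at h1
  have h2 : s ^ 2 * (1 / 2 * ⟪A e, e⟫)
      ≤ s ^ 2 * (ε / (2 * (‖e‖ ^ 2 + 1)) * ‖e‖ ^ 2) := by
    linarith
  have h3 := le_of_mul_le_mul_left h2 (by positivity)
  have h4 : ε / (2 * (‖e‖ ^ 2 + 1)) * ‖e‖ ^ 2 ≤ ε / 2 := by
    rw [div_mul_eq_mul_div, div_le_div_iff₀ (by positivity) (by positivity)]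
    nlinarith
  linarith

/-- `f` is touched from below at every point `x` by a paraboloid of opening `lam` and slope `q x`.
-/
def HasLowerParaboloids (f : E → ℝ) (q : E → E) (lam : ℝ) : Prop :=
  ∀ x y, f x + ⟪q x, y - x⟫ - lam * ‖y - x‖ ^ 2 ≤ f y

/-- Small linear perturbations of `Z = U + V - Q` have maxima inside the `r`-ball. The slope map
sends these maximum points onto a ball and is Lipschitz, so they have positive measure and almost
every property can be realized at one of them. -/
theorem exists_contact_point [FiniteDimensional ℝ E] {U V Q : E → ℝ} {qU qV gQ : E → E}
    {T : E →L[ℝ] E} {lam r β δ : ℝ} {x₀ : E} (hr : 0 < r) (hlam : 0 ≤ lam)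
    (hU : HasLowerParaboloids U qU lam) (hV : HasLowerParaboloids V qV lam)
    (hQ : ∀ x y, Q y = Q x + ⟪gQ x, y - x⟫ + 1 / 2 * ⟪T (y - x), y - x⟫)
    (hUc : Continuous U) (hVc : Continuous V) (h0 : Q x₀ ≤ U x₀ + V x₀) (hβ : 0 < β)
    (hann : ∀ x, r ≤ ‖x - x₀‖ → ‖x - x₀‖ ≤ 3 * r → U x + V x ≤ Q x - β) (hδ : 0 < δ) :
    ∃ x p A B, ‖x - x₀‖ ≤ r ∧ ‖p‖ ≤ δ ∧ qU x + qV x = gQ x + p ∧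
      Q x - δ ≤ U x + V x ∧ HasPeanoExpansionAt U (qU x) A x ∧
      HasPeanoExpansionAt V (qV x) B x ∧ ∀ e, ⟪A e, e⟫ + ⟪B e, e⟫ ≤ ⟪T e, e⟫ := by
  let _ : MeasurableSpace E := borel E
  have : BorelSpace E := ⟨rfl⟩
  -- Hausdorff measure of full dimension is a Haar measure and comes with the bound for Lipschitz
  -- images of arbitrary sets.
  set μ : Measure E := Measure.hausdorffMeasure (finrank ℝ E : ℝ) with hμ
  set Z : E → ℝ := fun x => U x + V x - Q x with hZ
  set G : E → E := fun x => qU x + qV x - gQ x with hG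
  set K := closedBall x₀ (3 * r) with hK
  have hQc : Continuous Q := by
    rw [funext (hQ x₀)]; fun_prop
  have hZc : Continuous Z := by fun_prop
  -- The three bounds serve, in order, `‖p‖ ≤ δ`, keeping the maxima out of the annulus, and the
  -- lower bound for `U + V`.
  obtain ⟨δ', hδ'0, hδ'1, hδ'2, hδ'3⟩ : ∃ δ' > 0, δ' ≤ δ ∧ 3 * r * δ' < β ∧ 3 * r * δ' ≤ δ := by
    refine ⟨min δ (min (β / (3 * r) / 2) (δ / (3 * r))), by positivity, min_le_left _ _, ?_, ?_⟩
    · have h1 : min δ (min (β / (3 * r) / 2) (δ / (3 * r))) ≤ β / (3 * r) / 2 :=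
        (min_le_right _ _).trans (min_le_left _ _)
      calc _ ≤ 3 * r * (β / (3 * r) / 2) := by gcongr
        _ = β / 2 := by field_simp
        _ < β := by linarith
    · have h1 : min δ (min (β / (3 * r) / 2) (δ / (3 * r))) ≤ δ / (3 * r) :=
        (min_le_right _ _).trans (min_le_right _ _)
      calc _ ≤ 3 * r * (δ / (3 * r)) := by gcongr
        _ = δ := by field_simp
  set S : Set E := {x | x ∈ closedBall x₀ r ∧
    ∃ p : E, ‖p‖ < δ' ∧ ∀ y ∈ K, Z y ≤ Z x + ⟪p, y - x⟫} with hS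
  have hTb : ∀ e, |⟪T e, e⟫| ≤ ‖T‖ * ‖e‖ ^ 2 := fun e => by
    refine (abs_real_inner_le_norm _ _).trans ?_
    have := T.le_opNorm e
    nlinarith [norm_nonneg e]
  have hTb1 := fun e => (abs_le.1 (hTb e)).1
  have hTb2 := fun e => (abs_le.1 (hTb e)).2
  have hSK : ∀ x ∈ S, K ∈ 𝓝 x := fun x hx => by
    refine Filter.mem_of_superset (isOpen_ball.mem_nhds (?_ : x ∈ ball x₀ (3 * r)))
      ball_subset_closedBall
    have := mem_closedBall.1 hx.1
    rw [mem_ball]; linarith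
  have hZlow : ∀ x y, Z x + ⟪G x, y - x⟫ - (2 * lam + ‖T‖) * ‖y - x‖ ^ 2 ≤ Z y := by
    intro x y
    have h1 := hU x y
    have h2 := hV x y
    have h3 := hQ x y
    have h4 := hTb2 (y - x)
    have h5 : 0 ≤ ‖T‖ * ‖y - x‖ ^ 2 := by positivity
    simp only [hZ, hG, inner_add_left, inner_sub_left]
    linarith
  have hSG : ∀ x ∈ S, ∀ p : E, (∀ y ∈ K, Z y ≤ Z x + ⟪p, y - x⟫) → G x = p := by
    intro x hx p hp
    refine sub_eq_zero.1 (eq_zero_of_inner_le_sq (C := 2 * lam + ‖T‖) ?_)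
    have hc : Tendsto (fun e : E => x + e) (𝓝 0) (𝓝 x) := by
      have : Continuous fun e : E => x + e := by fun_prop
      simpa using this.tendsto 0
    filter_upwards [hc (hSK x hx)] with e he
    have h1 := hp _ he
    have h2 := hZlow x (x + e)
    rw [add_sub_cancel_left] at h1 h2
    rw [inner_sub_left]
    linarith
  have hSle : ∀ x ∈ S, ∀ y ∈ K, Z y ≤ Z x + ⟪G x, y - x⟫ := by
    intro x hx y hy
    obtain ⟨p, -, hp⟩ := hx.2
    rw [hSG x hx p hp]
    exact hp y hy
  have hC0 : 0 ≤ 2 * lam + ‖T‖ := by positivity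
  have hcZ : HasQuadraticContact Z G (2 * lam + ‖T‖) S K := by
    intro x hx y hy
    have h1 := hSle x hx y hy
    have h2 := hZlow x y
    have : 0 ≤ (2 * lam + ‖T‖) * ‖y - x‖ ^ 2 := by positivity
    rw [abs_le]; constructor <;> linarith
  -- The upper bound for `U` comes from that for `Z` and the lower paraboloid of `V`, because `U = Z
  -- + Q - V`.
  have hcU : HasQuadraticContact U qU (2 * lam + ‖T‖) S K := by
    intro x hx y hy
    have h1 := hSle x hx y hy
    simp only [hZ, hG, inner_add_left, inner_sub_left] at h1
    have h2 := hU x y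
    have h3 := hV x y
    have h4 := hQ x y
    have h5 := hTb2 (y - x)
    have h6 : 0 ≤ lam * ‖y - x‖ ^ 2 := by positivity
    have h7 : 0 ≤ ‖T‖ * ‖y - x‖ ^ 2 := by positivity
    rw [abs_le]; constructor <;> linarith
  have hcV : HasQuadraticContact V qV (2 * lam + ‖T‖) S K := by
    intro x hx y hy
    have h1 := hSle x hx y hy
    simp only [hZ, hG, inner_add_left, inner_sub_left] at h1
    have h2 := hU x y
    have h3 := hV x y
    have h4 := hQ x y
    have h5 := hTb2 (y - x)
    have h6 : 0 ≤ lam * ‖y - x‖ ^ 2 := by positivity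
    have h7 : 0 ≤ ‖T‖ * ‖y - x‖ ^ 2 := by positivity
    rw [abs_le]; constructor <;> linarith
  have hSr : S ⊆ closedBall x₀ r := fun x hx => hx.1
  have hLZ := hcZ.lipschitzOnWith hC0 hSr
  have hLU := hcU.lipschitzOnWith hC0 hSr
  have hLV := hcV.lipschitzOnWith hC0 hSr
  have hx0K : x₀ ∈ K := mem_closedBall_self (by positivity)
  have hZ0 : 0 ≤ Z x₀ := by simp only [hZ]; linarith
  have himg : ball (0 : E) δ' ⊆ G '' S := by
    intro p hp
    have hp' : ‖p‖ < δ' := by simpa using hp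
    obtain ⟨x, hxK, hx⟩ := (isCompact_closedBall x₀ (3 * r)).exists_isMaxOn ⟨x₀, hx0K⟩
      (f := fun y => Z y - ⟪p, y⟫) (by fun_prop)
    have hmax : ∀ y ∈ K, Z y ≤ Z x + ⟪p, y - x⟫ := fun y hy => by
      have : Z y - ⟪p, y⟫ ≤ Z x - ⟪p, x⟫ := hx hy
      rw [inner_sub_right]; linarith
    have hx3 : ‖x - x₀‖ ≤ 3 * r := by simpa [dist_eq_norm, hK] using hxK
    have hxS : x ∈ S := by
      refine ⟨?_, p, hp', hmax⟩
      rw [mem_closedBall, dist_eq_norm]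
      by_contra hlt
      have h1 := hann x (not_le.1 hlt).le hx3
      have h2 := hmax x₀ hx0K
      have h3 := real_inner_le_norm p (x₀ - x)
      rw [norm_sub_rev] at h3
      have h4 : ‖p‖ * ‖x - x₀‖ ≤ δ' * (3 * r) := by gcongr
      have h5 : Z x ≤ -β := by simp only [hZ]; linarith
      linarith
    exact ⟨x, hxS, hSG x hxS p hmax⟩
  have hμS : μ S ≠ 0 := by
    intro h
    have h1 := hLZ.hausdorffMeasure_image_le (d := (finrank ℝ E : ℝ)) (by positivity)
    rw [← hμ, h, mul_zero] at h1
    have h2 : μ (ball (0 : E) δ') ≤ 0 := (measure_mono himg).trans h1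
    exact absurd h2 (not_le.2 (measure_ball_pos μ 0 hδ'0))
  obtain ⟨x, hxS, hxU, hxV, hxd⟩ : ∃ x ∈ S, DifferentiableWithinAt ℝ qU S x ∧
      DifferentiableWithinAt ℝ qV S x ∧
      Tendsto (fun r => μ (S ∩ closedBall x r) / μ (closedBall x r)) (𝓝[>] 0) (𝓝 1) := by
    by_contra hcon
    push Not at hcon
    apply hμS
    have h1 := hLU.ae_differentiableWithinAt_of_mem (μ := μ)
    have h2 := hLV.ae_differentiableWithinAt_of_mem (μ := μ)
    -- This density theorem holds for arbitrary sets, so measurability of `S` never enters.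
    have h3 := Besicovitch.ae_tendsto_measure_inter_div μ S
    have h4 : ∀ᵐ x ∂μ.restrict S, x ∉ S := by
      filter_upwards [ae_restrict_of_ae h1, ae_restrict_of_ae h2, h3] with x h1 h2 h3 hx
      exact hcon x hx (h1 hx) (h2 hx) h3
    rw [ae_iff] at h4
    simp only [not_not, Set.ofPred_mem_eq] at h4
    rwa [Measure.restrict_apply_self] at h4
  have hth := isThickAt_of_density_one μ S x hxd
  have hPU := hcU.hasPeanoExpansionAt hC0 (hSK x hxS) hxU.hasFDerivWithinAt hth
  have hPV := hcV.hasPeanoExpansionAt hC0 (hSK x hxS) hxV.hasFDerivWithinAt hth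
  set A := fderivWithin ℝ qU S x
  set B := fderivWithin ℝ qV S x
  obtain ⟨p, hpδ, hp⟩ := hxS.2
  have hGp := hSG x hxS p hp
  have hx3 : ‖x - x₀‖ ≤ r := by simpa [dist_eq_norm] using hxS.1
  refine ⟨x, p, A, B, hx3, hpδ.le.trans hδ'1, ?_, ?_, hPU, hPV, ?_⟩
  · rw [← hGp]; simp only [hG]; abel
  · have h2 := hp x₀ hx0K
    have h3 := real_inner_le_norm p (x₀ - x)
    rw [norm_sub_rev] at h3
    have h4 : ‖p‖ * ‖x - x₀‖ ≤ δ' * (3 * r) := by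
      gcongr; linarith
    simp only [hZ] at h2 hZ0
    linarith
  · intro e
    have hPZ : HasPeanoExpansionAt Z (G x) (A + B - T) x := by
      intro ε hε
      filter_upwards [hPU (ε / 2) (by positivity), hPV (ε / 2) (by positivity)] with y h1 h2
      have h3 : Z y - Z x - ⟪G x, y - x⟫ - 1 / 2 * ⟪(A + B - T) (y - x), y - x⟫
          = (U y - U x - ⟪qU x, y - x⟫ - 1 / 2 * ⟪A (y - x), y - x⟫)
            + (V y - V x - ⟪qV x, y - x⟫ - 1 / 2 * ⟪B (y - x), y - x⟫) := by
        simp only [hZ, hG, inner_add_left, inner_sub_left, _root_.sub_apply,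
          _root_.add_apply]
        rw [hQ x y]; ring
      rw [h3]
      exact (abs_add_le _ _).trans (by linarith)
    have := hPZ.inner_nonpos_of_isLocalMax
      (Filter.mem_of_superset (hSK x hxS) (hSle x hxS)) e
    simp only [_root_.sub_apply, _root_.add_apply, inner_add_left,
      inner_sub_left] at this
    linarith

end Jensen

/-! ### Jets, quadratic polynomials and test functions. -/

section Jets

variable {n : ℕ}

/-- The continuous linear map with matrix `S`. -/
noncomputable abbrev symCLM (S : SymMat n) :
    EuclideanSpace ℝ (Fin n) →L[ℝ] EuclideanSpace ℝ (Fin n) :=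
  Matrix.toEuclideanCLM (n := Fin n) (𝕜 := ℝ) (S : Matrix (Fin n) (Fin n) ℝ)

/-- The quadratic polynomial whose 2-jet at `y` is `(r, p, S)`. -/
noncomputable def quadPoly (r : ℝ) (p : EuclideanSpace ℝ (Fin n)) (S : SymMat n)
    (y x : EuclideanSpace ℝ (Fin n)) : ℝ :=
  r + ⟪p, x - y⟫ + 1 / 2 * ⟪symCLM S (x - y), x - y⟫

theorem symCLM_add (S T : SymMat n) : symCLM (S + T) = symCLM S + symCLM T := by
  simp [symCLM]

theorem symCLM_sub (S T : SymMat n) : symCLM (S - T) = symCLM S - symCLM T := by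
  simp [symCLM]

theorem symCLM_smul (c : ℝ) (S : SymMat n) : symCLM (c • S) = c • symCLM S := by
  simp [symCLM]

/-- The identity matrix as a symmetric matrix. -/
def symOne (n : ℕ) : SymMat n := ⟨1, Matrix.isSymm_one⟩

theorem symCLM_symOne : symCLM (symOne n) = 1 := by
  simp [symCLM, symOne]

theorem inner_symCLM_single (S : SymMat n) (i j : Fin n) :
    ⟪symCLM S (EuclideanSpace.single i 1), EuclideanSpace.single j 1⟫
      = (S : Matrix (Fin n) (Fin n) ℝ) i j := by
  rw [EuclideanSpace.inner_single_right]
  simp [symCLM, Matrix.mulVec_single]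
  exact congrFun (congrFun S.2 i) j

theorem inner_symCLM_comm (S : SymMat n) (a b : EuclideanSpace ℝ (Fin n)) :
    ⟪symCLM S a, b⟫ = ⟪symCLM S b, a⟫ := by
  have h : star (S : Matrix (Fin n) (Fin n) ℝ) = S := by
    rw [Matrix.star_eq_conjTranspose, Matrix.conjTranspose_eq_transpose_of_trivial]; exact S.2
  have h1 : star (symCLM S) = symCLM S := by
    simp only [symCLM]; rw [← map_star, h]
  rw [ContinuousLinearMap.star_eq_adjoint] at h1
  rw [real_inner_comm, ← ContinuousLinearMap.adjoint_inner_left, h1]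

/-- A derivative taken within a contact set is not known to be symmetric; only its quadratic form
matters, so it is symmetrized. -/
theorem exists_symCLM_inner_self (A : EuclideanSpace ℝ (Fin n) →L[ℝ] EuclideanSpace ℝ (Fin n)) :
    ∃ S : SymMat n, ∀ e, ⟪symCLM S e, e⟫ = ⟪A e, e⟫ := by
  obtain ⟨N, rfl⟩ := (Matrix.toEuclideanCLM (n := Fin n) (𝕜 := ℝ)).surjective A
  refine ⟨⟨(1 / 2 : ℝ) • (N + Nᵀ), ?_⟩, fun e => ?_⟩
  · show ((1 / 2 : ℝ) • (N + Nᵀ))ᵀ = _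
    simp [add_comm]
  · have h1 : Matrix.toEuclideanCLM (n := Fin n) (𝕜 := ℝ) Nᵀ
        = ContinuousLinearMap.adjoint (Matrix.toEuclideanCLM (n := Fin n) (𝕜 := ℝ) N) := by
      rw [← ContinuousLinearMap.star_eq_adjoint, ← map_star, Matrix.star_eq_conjTranspose,
        Matrix.conjTranspose_eq_transpose_of_trivial]
    simp only [symCLM, map_smul, map_add, h1, _root_.add_apply, _root_.smul_apply,
      real_inner_smul_left, inner_add_left, ContinuousLinearMap.adjoint_inner_left]
    rw [real_inner_comm]
    ring_nf
    exact real_inner_comm _ _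

theorem posSemidef_of_inner_symCLM_nonneg {S : SymMat n} (h : ∀ e, 0 ≤ ⟪symCLM S e, e⟫) :
    (S : Matrix (Fin n) (Fin n) ℝ).PosSemidef := by
  refine Matrix.PosSemidef.of_dotProduct_mulVec_nonneg ?_ fun x => ?_
  · rw [Matrix.IsHermitian, Matrix.conjTranspose_eq_transpose_of_trivial]; exact S.2
  · have := h (WithLp.toLp 2 x)
    simpa [symCLM, EuclideanSpace.inner_eq_star_dotProduct] using this

theorem quadPoly_self (r : ℝ) (p : EuclideanSpace ℝ (Fin n)) (S : SymMat n)
    (y : EuclideanSpace ℝ (Fin n)) : quadPoly r p S y y = r := by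
  simp [quadPoly]

theorem quadPoly_expand (r : ℝ) (p : EuclideanSpace ℝ (Fin n)) (S : SymMat n)
    (z x y : EuclideanSpace ℝ (Fin n)) :
    quadPoly r p S z y = quadPoly r p S z x + ⟪p + symCLM S (x - z), y - x⟫
      + 1 / 2 * ⟪symCLM S (y - x), y - x⟫ := by
  have e : y - z = (x - z) + (y - x) := by abel
  have h := inner_symCLM_comm S (x - z) (y - x)
  simp only [quadPoly]
  rw [e]
  generalize x - z = a at *
  generalize y - x = b at *
  simp only [map_add, inner_add_left, inner_add_right]
  linarith

theorem hasFDerivAt_quadPoly (r : ℝ) (p : EuclideanSpace ℝ (Fin n)) (S : SymMat n)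
    (y x : EuclideanSpace ℝ (Fin n)) :
    HasFDerivAt (quadPoly r p S y) (innerSL ℝ (p + symCLM S (x - y))) x := by
  rw [hasFDerivAt_iff_isLittleO]
  have h : ∀ z, quadPoly r p S y z - quadPoly r p S y x
      - innerSL ℝ (p + symCLM S (x - y)) (z - x) = 1 / 2 * ⟪symCLM S (z - x), z - x⟫ := fun z => by
    rw [quadPoly_expand r p S y x z, innerSL_apply_apply]; ring
  simp only [h]
  refine Asymptotics.IsBigO.trans_isLittleO (g := fun z => ‖z - x‖ ^ 2) ?_ ?_
  · refine Asymptotics.IsBigO.of_bound (‖symCLM S‖) (Eventually.of_forall fun z => ?_)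
    have h1 := norm_inner_le_norm (𝕜 := ℝ) (symCLM S (z - x)) (z - x)
    have h2 := (symCLM S).le_opNorm (z - x)
    rw [norm_mul, norm_pow, norm_norm, Real.norm_of_nonneg (by norm_num : (0 : ℝ) ≤ 1 / 2)]
    have h3 := mul_le_mul_of_nonneg_right h2 (norm_nonneg (z - x))
    have h4 : 0 ≤ ‖symCLM S‖ * ‖z - x‖ ^ 2 := by positivity
    linarith
  · have h1 : Tendsto (fun z => z - x) (𝓝 x) (𝓝 0) := by
      have : Continuous fun z : EuclideanSpace ℝ (Fin n) => z - x := by fun_prop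
      simpa using this.tendsto x
    exact (Asymptotics.isLittleO_norm_pow_id (one_lt_two)).comp_tendsto h1

theorem contDiff_quadPoly (r : ℝ) (p : EuclideanSpace ℝ (Fin n)) (S : SymMat n)
    (y : EuclideanSpace ℝ (Fin n)) : ContDiff ℝ 2 (quadPoly r p S y) := by
  unfold quadPoly
  have h : ContDiff ℝ 2 fun x : EuclideanSpace ℝ (Fin n) => x - y := by fun_prop
  exact (contDiff_const.add (contDiff_const.inner ℝ h)).add
    (contDiff_const.mul ((((symCLM S).contDiff).comp h).inner ℝ h))

theorem isJetAt_quadPoly (r : ℝ) (p : EuclideanSpace ℝ (Fin n)) (S : SymMat n)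
    (y : EuclideanSpace ℝ (Fin n)) : IsJetAt (quadPoly r p S y) y (r, p, S) := by
  refine ⟨(quadPoly_self r p S y).symm, ?_, fun i j => ?_⟩
  · have := hasFDerivAt_quadPoly r p S y y
    rw [sub_self, map_zero, add_zero] at this
    have h2 : HasGradientAt (quadPoly r p S y) p y := by
      rw [hasGradientAt_iff_hasFDerivAt]; exact this
    exact h2.gradient.symm
  · have h1 : fderiv ℝ (quadPoly r p S y) = fun x => innerSL ℝ (p + symCLM S (x - y)) :=
      funext fun x => (hasFDerivAt_quadPoly r p S y x).fderiv
    have h2 : HasFDerivAt (fun x => innerSL ℝ (p + symCLM S (x - y)))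
        ((innerSL ℝ : EuclideanSpace ℝ (Fin n) →L[ℝ] _).comp (symCLM S)) y := by
      have h3 : HasFDerivAt (fun x => p + symCLM S (x - y)) (symCLM S) y := by
        have := ((symCLM S).hasFDerivAt.comp y ((hasFDerivAt_id y).sub_const y)).const_add p
        simpa using this
      exact (innerSL ℝ : EuclideanSpace ℝ (Fin n) →L[ℝ] _).hasFDerivAt.comp y h3
    rw [h1, h2.fderiv]
    exact (inner_symCLM_single S i j).symm

/-- Mean value inequality for `φ` minus its quadratic polynomial, whose derivative is at most `ε ‖y
- x‖` on the ball of radius `‖y - x‖`. -/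
theorem IsJetAt.hasPeanoExpansionAt {φ : EuclideanSpace ℝ (Fin n) → ℝ}
    {x : EuclideanSpace ℝ (Fin n)} {J : Jet2 n} (hφ : ContDiffAt ℝ 2 φ x) (hJ : IsJetAt φ x J) :
    HasPeanoExpansionAt φ J.2.1 (symCLM J.2.2) x := by
  obtain ⟨r, p, S⟩ := J
  obtain ⟨-, hp, hS⟩ := hJ
  simp only at hp hS
  intro ε hε
  have hd1 : ∀ᶠ y in 𝓝 x, DifferentiableAt ℝ φ y := by
    filter_upwards [hφ.eventually (by simp)] with y hy using hy.differentiableAt (by simp)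
  have hd2 : DifferentiableAt ℝ (fderiv ℝ φ) x :=
    (hφ.fderiv_right (m := 1) (by norm_num)).differentiableAt (by simp)
  have hx : fderiv ℝ φ x = innerSL ℝ p := by
    have := hφ.differentiableAt (by simp)
    have h1 := this.hasGradientAt
    rw [← hp, hasGradientAt_iff_hasFDerivAt] at h1
    exact h1.fderiv
  have hD : fderiv ℝ (fderiv ℝ φ) x
      = (innerSL ℝ : EuclideanSpace ℝ (Fin n) →L[ℝ] _).comp (symCLM S) := by
    have h1 : ∀ i j, fderiv ℝ (fderiv ℝ φ) x (EuclideanSpace.single i 1)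
        (EuclideanSpace.single j 1) = (innerSL ℝ : EuclideanSpace ℝ (Fin n) →L[ℝ] _).comp
          (symCLM S) (EuclideanSpace.single i 1) (EuclideanSpace.single j 1) := fun i j => by
      rw [← hS]; exact (inner_symCLM_single S i j).symm
    let b := (EuclideanSpace.basisFun (Fin n) ℝ).toBasis
    apply ContinuousLinearMap.coe_injective
    refine b.ext fun i => ?_
    apply ContinuousLinearMap.coe_injective
    refine b.ext fun j => ?_
    simpa [b] using h1 i j
  have ho := (hasFDerivAt_iff_isLittleO.1 hd2.hasFDerivAt).def hε
  obtain ⟨ρ, hρ, hball⟩ := Metric.eventually_nhds_iff_ball.1 (ho.and hd1)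
  filter_upwards [ball_mem_nhds x hρ] with y hy
  have hyρ : ‖y - x‖ < ρ := by simpa [dist_eq_norm] using hy
  have hsub : ∀ z ∈ closedBall x ‖y - x‖, z ∈ ball x ρ := fun z hz => by
    rw [mem_closedBall] at hz; rw [mem_ball]; linarith
  have hmv := (convex_closedBall x ‖y - x‖).norm_image_sub_le_of_norm_hasFDerivWithin_le
    (f := fun z => φ z - quadPoly r p S x z)
    (f' := fun z => fderiv ℝ φ z - innerSL ℝ (p + symCLM S (z - x))) (C := ε * ‖y - x‖)
    (x := x) (y := y)
    (fun z hz => (((hball z (hsub z hz)).2.hasFDerivAt).sub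
      (hasFDerivAt_quadPoly r p S x z)).hasFDerivWithinAt) (fun z hz => by
      have h2 := (hball z (hsub z hz)).1
      rw [hx, hD] at h2
      rw [mem_closedBall, dist_eq_norm] at hz
      have e : fderiv ℝ φ z - innerSL ℝ (p + symCLM S (z - x)) = fderiv ℝ φ z - innerSL ℝ p
          - (innerSL ℝ : EuclideanSpace ℝ (Fin n) →L[ℝ] _).comp (symCLM S) (z - x) := by
        rw [map_add, ContinuousLinearMap.comp_apply]; abel
      rw [e]
      exact h2.trans (by gcongr))
    (mem_closedBall_self (norm_nonneg _)) (by rw [mem_closedBall, dist_eq_norm])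
  rw [quadPoly_self, Real.norm_eq_abs] at hmv
  have e2 : φ y - φ x - ⟪p, y - x⟫ - 1 / 2 * ⟪symCLM S (y - x), y - x⟫
      = φ y - quadPoly r p S x y - (φ x - r) := by
    simp only [quadPoly]; ring
  show |φ y - φ x - ⟪p, y - x⟫ - 1 / 2 * ⟪symCLM S (y - x), y - x⟫| ≤ _
  rw [e2]
  exact hmv.trans (le_of_eq (by ring))

theorem neg_mem_lowerTestJets {w : EuclideanSpace ℝ (Fin n) → EReal}
    {y : EuclideanSpace ℝ (Fin n)} {J : Jet2 n} (h : J ∈ upperTestJets (fun x => -w x) y) :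
    -J ∈ lowerTestJets w y := by
  obtain ⟨φ, hφ, hle, heq, hJ⟩ := h
  refine ⟨fun x => -φ x, hφ.neg, ?_, ?_, ?_, ?_, fun i j => ?_⟩
  · filter_upwards [hle] with x hx
    rw [EReal.coe_neg]
    exact EReal.neg_le.1 hx
  · rw [EReal.coe_neg, ← heq, neg_neg]
  · exact congrArg Neg.neg hJ.1
  · have := hJ.2.1
    show -J.2.1 = _
    rw [this, gradient, gradient, fderiv_fun_neg, map_neg]
  · have := hJ.2.2 i j
    have h1 : fderiv ℝ (fun x => -φ x) = fun x => -fderiv ℝ φ x := funext fun x => fderiv_fun_neg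
    rw [h1, fderiv_fun_neg]
    show -((J.2.2 : Matrix (Fin n) (Fin n) ℝ) i j) = _
    rw [this]; rfl

/-- The "magic property" of sup-convolutions: translating by `x - y` keeps the penalty constant, so
the expansion of `U` at `x` bounds `u` near `y`. The extra `η • symOne n` absorbs the Peano error.
-/
theorem mem_upperTestJets_of_hasPeanoExpansionAt {u : EuclideanSpace ℝ (Fin n) → EReal}
    {U : EuclideanSpace ℝ (Fin n) → ℝ} {lam : ℝ} {x y q : EuclideanSpace ℝ (Fin n)}
    {K : Set (EuclideanSpace ℝ (Fin n))}
    {A : EuclideanSpace ℝ (Fin n) →L[ℝ] EuclideanSpace ℝ (Fin n)} {S : SymMat n} {η : ℝ}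
    (hη : 0 < η) (hK : K ∈ 𝓝 y) (hy : u y = ((U x + lam * ‖x - y‖ ^ 2 : ℝ) : EReal))
    (hle : ∀ x', ∀ y' ∈ K, u y' ≤ ((U x' + lam * ‖x' - y'‖ ^ 2 : ℝ) : EReal))
    (hU : HasPeanoExpansionAt U q A x) (hS : ∀ e, ⟪symCLM S e, e⟫ = ⟪A e, e⟫) :
    (U x + lam * ‖x - y‖ ^ 2, q, S + η • symOne n) ∈ upperTestJets u y := by
  refine ⟨quadPoly (U x + lam * ‖x - y‖ ^ 2) q (S + η • symOne n) y,
    (contDiff_quadPoly _ _ _ _).contDiffAt, ?_, by rw [quadPoly_self, hy], isJetAt_quadPoly _ _ _ _⟩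
  have ht : Tendsto (fun z => x + (z - y)) (𝓝 y) (𝓝 x) := by
    have : Continuous fun z : EuclideanSpace ℝ (Fin n) => x + (z - y) := by fun_prop
    simpa using this.tendsto y
  filter_upwards [ht.eventually (hU (η / 2) (by positivity)), hK] with z hz hzK
  refine (hle (x + (z - y)) z hzK).trans (EReal.coe_le_coe_iff.2 ?_)
  have e1 : x + (z - y) - z = x - y := by abel
  rw [add_sub_cancel_left] at hz
  have h1 := (abs_le.1 hz).2
  rw [e1, quadPoly, symCLM_add, symCLM_smul, symCLM_symOne, _root_.add_apply, inner_add_left, hS,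
    _root_.smul_apply, real_inner_smul_left]
  have h2 : ⟪(1 : EuclideanSpace ℝ (Fin n) →L[ℝ] EuclideanSpace ℝ (Fin n)) (z - y), z - y⟫
      = ‖z - y‖ ^ 2 := by
    rw [one_apply_eq_self, real_inner_self_eq_norm_sq]
  rw [h2]
  linarith

end Jets

/-! ### Sup-convolutions and penalization. -/

section SupConvolution

variable {E : Type*} [NormedAddCommGroup E]

/-- `U` is the sup-convolution of `a` over `K` with parameter `lam`, the supremum at `x` being
attained at `Y x`. -/
structure IsSupConvolution (a : E → EReal) (K : Set E) (lam : ℝ) (U : E → ℝ) (Y : E → E) :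
    Prop where
  mem : ∀ x, Y x ∈ K
  apply_eq : ∀ x, a (Y x) = ((U x + lam * ‖x - Y x‖ ^ 2 : ℝ) : EReal)
  apply_le : ∀ x, ∀ y ∈ K, a y ≤ ((U x + lam * ‖x - y‖ ^ 2 : ℝ) : EReal)

theorem exists_isSupConvolution {a : E → EReal} {K : Set E} (hK : IsCompact K)
    (ha : UpperSemicontinuousOn a K) (hat : ∀ x ∈ K, a x ≠ ⊤) {x₀ : E} (hx₀ : x₀ ∈ K)
    (hb : a x₀ ≠ ⊥) (lam : ℝ) : ∃ U Y, IsSupConvolution a K lam U Y := by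
  have key : ∀ x, ∃ (r : ℝ) (y : E), y ∈ K ∧ a y = ((r + lam * ‖x - y‖ ^ 2 : ℝ) : EReal) ∧
      ∀ z ∈ K, a z ≤ ((r + lam * ‖x - z‖ ^ 2 : ℝ) : EReal) := by
    intro x
    have hc : Continuous fun y : E => ((-(lam * ‖x - y‖ ^ 2) : ℝ) : EReal) :=
      continuous_coe_real_ereal.comp (by fun_prop)
    have husc : UpperSemicontinuousOn (fun y => a y + ((-(lam * ‖x - y‖ ^ 2) : ℝ) : EReal)) K :=
      ha.add' (hc.upperSemicontinuous.upperSemicontinuousOn K) fun y _ =>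
        EReal.continuousAt_add (Or.inr (EReal.coe_ne_bot _)) (Or.inr (EReal.coe_ne_top _))
    obtain ⟨y, hyK, hy⟩ := husc.exists_isMaxOn ⟨x₀, hx₀⟩ hK
    have hy' : ∀ z ∈ K, a z + ((-(lam * ‖x - z‖ ^ 2) : ℝ) : EReal)
        ≤ a y + ((-(lam * ‖x - y‖ ^ 2) : ℝ) : EReal) := fun z hz => hy hz
    have hyb : a y ≠ ⊥ := by
      intro h
      have h0 := hy' x₀ hx₀
      rw [h, EReal.bot_add, le_bot_iff, EReal.add_eq_bot_iff] at h0
      exact h0.elim hb (EReal.coe_ne_bot _)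
    obtain ⟨s, hs⟩ : ∃ s : ℝ, a y = s := ⟨_, (EReal.coe_toReal (hat y hyK) hyb).symm⟩
    refine ⟨s - lam * ‖x - y‖ ^ 2, y, hyK, by rw [hs]; congr 1; ring, fun z hz => ?_⟩
    rcases eq_or_ne (a z) ⊥ with hzb | hzb
    · rw [hzb]; exact bot_le
    obtain ⟨t, ht⟩ : ∃ t : ℝ, a z = t := ⟨_, (EReal.coe_toReal (hat z hz) hzb).symm⟩
    have h0 := hy' z hz
    rw [hs, ht, ← EReal.coe_add, ← EReal.coe_add, EReal.coe_le_coe_iff] at h0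
    rw [ht, EReal.coe_le_coe_iff]
    linarith
  choose U Y h1 h2 h3 using key
  exact ⟨U, Y, h1, h2, h3⟩

theorem UpperSemicontinuousOn.exists_real_bound {X : Type*} [TopologicalSpace X]
    {a : X → EReal} {K : Set X} (hK : IsCompact K)
    (ha : UpperSemicontinuousOn a K) (hat : ∀ x ∈ K, a x ≠ ⊤) :
    ∃ B : ℝ, ∀ x ∈ K, a x ≤ B := by
  rcases K.eq_empty_or_nonempty with rfl | hne
  · exact ⟨0, by simp⟩
  obtain ⟨y, hyK, hy⟩ := ha.exists_isMaxOn hne hK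
  obtain ⟨B, hB, -⟩ := EReal.lt_iff_exists_real_btwn.1 (lt_top_iff_ne_top.2 (hat y hyK))
  exact ⟨B, fun x hx => (hy hx).trans hB.le⟩

theorem EReal.exists_real_add_lt {a b : EReal} {g : ℝ} (ha : a ≠ ⊤) (hb : b ≠ ⊤)
    (h : a + b < g) : ∃ α β : ℝ, a < α ∧ b < β ∧ α + β < g := by
  rcases eq_or_ne a ⊥ with rfl | ha'
  · obtain ⟨β, hβ, -⟩ := EReal.lt_iff_exists_real_btwn.1 (lt_top_iff_ne_top.2 hb)
    exact ⟨g - β - 1, β, EReal.bot_lt_coe _, hβ, by linarith⟩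
  rcases eq_or_ne b ⊥ with rfl | hb'
  · obtain ⟨α, hα, -⟩ := EReal.lt_iff_exists_real_btwn.1 (lt_top_iff_ne_top.2 ha)
    exact ⟨α, g - α - 1, hα, EReal.bot_lt_coe _, by linarith⟩
  lift a to ℝ using ⟨ha, ha'⟩
  lift b to ℝ using ⟨hb, hb'⟩
  rw [← EReal.coe_add, EReal.coe_lt_coe_iff] at h
  refine ⟨a + (g - a - b) / 3, b + (g - a - b) / 3, ?_, ?_, by linarith⟩ <;>
    rw [EReal.coe_lt_coe_iff] <;> linarith

/-- If `y` and `z` lie within a Lebesgue number `d` of `x`, semicontinuity preserves the strict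
inequality; otherwise the penalty is at least `lam * d ^ 2` and beats the upper bounds of `a` and
`b`. -/
theorem exists_penalization {a b : E → EReal} {K A : Set E} (hK : IsCompact K)
    (ha : UpperSemicontinuousOn a K) (hat : ∀ x ∈ K, a x ≠ ⊤) (hb : UpperSemicontinuousOn b K)
    (hbt : ∀ x ∈ K, b x ≠ ⊤) (hA : IsCompact A) (hAK : A ⊆ K) {g : E → ℝ} (hg : Continuous g)
    (hlt : ∀ x ∈ A, a x + b x < g x) :
    ∃ L : ℝ, ∀ lam ≥ L, ∀ x ∈ A, ∀ y ∈ K, ∀ z ∈ K, ∀ s t : ℝ, a y = s → b z = t →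
      s + t - lam * ‖x - y‖ ^ 2 - lam * ‖x - z‖ ^ 2 ≤ g x := by
  have hloc : ∀ x : A, ∃ ρ > 0, ∀ x' y z, x' ∈ ball (x : E) ρ → y ∈ ball (x : E) ρ → y ∈ K →
      z ∈ ball (x : E) ρ → z ∈ K → ∀ s t : ℝ, a y = s → b z = t → s + t ≤ g x' := by
    rintro ⟨x, hx⟩
    obtain ⟨α, β, hα, hβ, hαβ⟩ := EReal.exists_real_add_lt (hat x (hAK hx)) (hbt x (hAK hx))
      (hlt x hx)
    have h1 := ha x (hAK hx) _ hα
    have h2 := hb x (hAK hx) _ hβ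
    have h3 := hg.continuousAt.eventually_const_lt hαβ
    rw [eventually_nhdsWithin_iff] at h1 h2
    obtain ⟨ρ, hρ, hball⟩ := Metric.eventually_nhds_iff_ball.1 ((h1.and h2).and h3)
    refine ⟨ρ, hρ, fun x' y z hx' hy hyK hz hzK s t hs ht => ?_⟩
    have h4 : a y < α := (hball y hy).1.1 hyK
    have h5 : b z < β := (hball z hz).1.2 hzK
    have h6 := (hball x' hx').2
    rw [hs, EReal.coe_lt_coe_iff] at h4
    rw [ht, EReal.coe_lt_coe_iff] at h5
    linarith
  choose ρ hρ hloc using hloc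
  obtain ⟨d, hd, hleb⟩ := lebesgue_number_lemma_of_metric hA (c := fun x : A => ball (x : E) (ρ x))
    (fun _ => isOpen_ball) fun x hx => mem_iUnion.2 ⟨⟨x, hx⟩, mem_ball_self (hρ _)⟩
  obtain ⟨B₁, hB₁⟩ := ha.exists_real_bound hK hat
  obtain ⟨B₂, hB₂⟩ := hb.exists_real_bound hK hbt
  obtain ⟨m, hm⟩ := (hA.image hg).bddBelow
  refine ⟨max 0 ((B₁ + B₂ - m) / d ^ 2), fun lam hlam x hx y hy z hz s t hs ht => ?_⟩
  have hlam0 : 0 ≤ lam := (le_max_left _ _).trans hlam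
  have hlam1 : B₁ + B₂ - m ≤ lam * d ^ 2 := by
    have := (le_max_right _ _).trans hlam
    rwa [div_le_iff₀ (by positivity)] at this
  have hs1 := hB₁ y hy
  have ht1 := hB₂ z hz
  rw [hs, EReal.coe_le_coe_iff] at hs1
  rw [ht, EReal.coe_le_coe_iff] at ht1
  have hm1 : m ≤ g x := hm (mem_image_of_mem g hx)
  have p1 : 0 ≤ lam * ‖x - y‖ ^ 2 := by positivity
  have p2 : 0 ≤ lam * ‖x - z‖ ^ 2 := by positivity
  by_cases hyd : ‖x - y‖ < d
  · by_cases hzd : ‖x - z‖ < d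
    · obtain ⟨i, hi⟩ := hleb x hx
      have := hloc i x y z (hi (mem_ball_self hd))
        (hi (by rwa [mem_ball, dist_eq_norm, norm_sub_rev])) hy
        (hi (by rwa [mem_ball, dist_eq_norm, norm_sub_rev])) hz s t hs ht
      linarith
    · have : lam * d ^ 2 ≤ lam * ‖x - z‖ ^ 2 := by
        gcongr; exact not_lt.1 hzd
      linarith
  · have : lam * d ^ 2 ≤ lam * ‖x - y‖ ^ 2 := by
      gcongr; exact not_lt.1 hyd
    linarith

variable [InnerProductSpace ℝ E]

/-- Use the maximizer `Y x` as a competitor at `y` and expand the square. -/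
theorem IsSupConvolution.hasLowerParaboloids {a : E → EReal} {K : Set E} {lam : ℝ} {U : E → ℝ}
    {Y : E → E} (h : IsSupConvolution a K lam U Y) :
    HasLowerParaboloids U (fun x => (-2 * lam) • (x - Y x)) lam := by
  intro x y
  have h1 := h.apply_le y (Y x) (h.mem x)
  rw [h.apply_eq x, EReal.coe_le_coe_iff] at h1
  have e : y - Y x = (x - Y x) + (y - x) := by abel
  rw [e, norm_add_sq_real] at h1
  rw [real_inner_smul_left]
  linarith

theorem HasLowerParaboloids.continuous {f : E → ℝ} {q : E → E} {lam a b : ℝ}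
    (h : HasLowerParaboloids f q lam) (hb : 0 ≤ b)
    (hq : ∀ x, ‖q x‖ ≤ a + b * ‖x‖) :
    Continuous f := by
  refine continuous_iff_continuousAt.2 fun x => ?_
  have hc : Continuous fun y : E => (a + b * (‖x‖ + ‖y‖)) * ‖y - x‖ + lam * ‖y - x‖ ^ 2 := by
    fun_prop
  have ht := hc.tendsto x
  simp only [sub_self, norm_zero, mul_zero, ne_eq, OfNat.ofNat_ne_zero, not_false_eq_true,
    zero_pow, add_zero] at ht
  refine tendsto_iff_norm_sub_tendsto_zero.2 (squeeze_zero (fun _ => norm_nonneg _) (fun y => ?_) ht)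
  have h1 := h x y
  have h2 := h y x
  have b1 := (abs_le.1 (abs_real_inner_le_norm (q x) (y - x))).1
  have b2 := (abs_le.1 (abs_real_inner_le_norm (q y) (x - y))).1
  rw [norm_sub_rev x y] at b2 h2
  have n0 := norm_nonneg (y - x)
  have c1 : ‖q x‖ * ‖y - x‖ ≤ (a + b * (‖x‖ + ‖y‖)) * ‖y - x‖ := by
    gcongr
    nlinarith [hq x, norm_nonneg y]
  have c2 : ‖q y‖ * ‖y - x‖ ≤ (a + b * (‖x‖ + ‖y‖)) * ‖y - x‖ := by
    gcongr
    nlinarith [hq y, norm_nonneg x]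
  rw [Real.norm_eq_abs, abs_le]
  constructor <;> linarith

theorem IsSupConvolution.continuous {a : E → EReal} {K : Set E} {lam : ℝ} {U : E → ℝ}
    {Y : E → E} (h : IsSupConvolution a K lam U Y) (hlam : 0 ≤ lam) (hK : Bornology.IsBounded K) :
    Continuous U := by
  obtain ⟨R, hR⟩ := hK.exists_norm_le
  refine h.hasLowerParaboloids.continuous (a := 2 * lam * R) (b := 2 * lam) (by positivity)
    fun x => ?_
  rw [norm_smul, norm_mul, norm_neg, Real.norm_of_nonneg hlam, Real.norm_of_nonneg zero_le_two]
  calc _ ≤ 2 * lam * (‖x‖ + R) := by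
        gcongr
        exact (norm_sub_le _ _).trans (by gcongr; exact hR _ (h.mem x))
    _ = _ := by ring

end SupConvolution

/-! ### Strict monotonicity of the operator and exclusion of strict touching. -/

section Comparison

variable {n : ℕ}

theorem IsMonotonicityConeSubequation.add_mem {M : Set (Jet2 n)}
    (hM : IsMonotonicityConeSubequation M) {J K : Jet2 n} (hJ : J ∈ M) (hK : K ∈ M) :
    J + K ∈ M := by
  have h := hM.convex hJ hK (a := 1 / 2) (b := 1 / 2) (by norm_num) (by norm_num) (by norm_num)
  have h2 := hM.cone 2 zero_le_two _ h
  rwa [smul_add, smul_smul, smul_smul, show (2 : ℝ) * (1 / 2) = 1 by norm_num, one_smul,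
    one_smul] at h2

theorem IsMonotonicityConeSubequation.smul_mem_interior {M : Set (Jet2 n)}
    (hM : IsMonotonicityConeSubequation M) {J : Jet2 n} (hJ : J ∈ interior M) {t : ℝ}
    (ht : 0 < t) : t • J ∈ interior M := by
  have hc : Continuous fun L : Jet2 n => t⁻¹ • L := by fun_prop
  refine mem_interior.2 ⟨(fun L : Jet2 n => t⁻¹ • L) ⁻¹' interior M, fun L hL => ?_,
    isOpen_interior.preimage hc, ?_⟩
  · have h := hM.cone t ht.le _ (interior_subset hL)
    rwa [smul_smul, mul_inv_cancel₀ ht.ne', one_smul] at h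
  · simpa [smul_smul, inv_mul_cancel₀ ht.ne'] using hJ

theorem IsMonotonicityConeSubequation.add_mem_interior {M : Set (Jet2 n)}
    (hM : IsMonotonicityConeSubequation M) {J K : Jet2 n} (hJ : J ∈ interior M) (hK : K ∈ M) :
    J + K ∈ interior M := by
  have hc : Continuous fun L : Jet2 n => L - K := by fun_prop
  refine mem_interior.2 ⟨(fun L : Jet2 n => L - K) ⁻¹' interior M, fun L hL => ?_,
    isOpen_interior.preimage hc, ?_⟩
  · have h := hM.add_mem (interior_subset hL) hK
    rwa [sub_add_cancel] at h
  · simpa using hJ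

/-- Since `K - t • J₀` is still in `M` for some `t > 0`, adding `K` moves the endpoint of the
half-line down by at least `t`. -/
theorem canonicalOperator_lt_add {F M : Set (Jet2 n)} (hF : IsSubequation F)
    (hM : IsMonotonicityConeSubequation M) (hFM : IsMonotoneFor F M) {J₀ : Jet2 n}
    (hJ₀ : J₀ ∈ interior M) (J : Jet2 n) {K : Jet2 n} (hK : K ∈ interior M) :
    canonicalOperator F J₀ J < canonicalOperator F J₀ (J + K) := by
  have hc : Continuous fun t : ℝ => K - t • J₀ := by fun_prop
  have h0 := (isOpen_interior.preimage hc).mem_nhds (x := 0) (by simpa using hK)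
  have h1 : ∀ᶠ t in 𝓝[>] (0 : ℝ), K - t • J₀ ∈ interior M := nhdsWithin_le_nhds h0
  obtain ⟨t, ht, ht0⟩ := (h1.and self_mem_nhdsWithin).exists
  have ht0 : 0 < t := ht0
  set s := -canonicalOperator F J₀ J with hs
  have h2 : J + s • J₀ ∈ F :=
    (Set.ext_iff.1 (canonicalOperator_halfLine hF hM hFM hJ₀ J) s).2 self_mem_Ici
  have h3 := hFM _ h2 _ (interior_subset ht)
  have h4 : J + s • J₀ + (K - t • J₀) = J + K + (s - t) • J₀ := by
    have h5 : (s - t) • J₀ = s • J₀ - t • J₀ := sub_smul s t J₀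
    rw [h5]; abel
  rw [h4] at h3
  have h5 : -canonicalOperator F J₀ (J + K) ≤ s - t :=
    (Set.ext_iff.1 (canonicalOperator_halfLine hF hM hFM hJ₀ (J + K)) (s - t)).1 h3
  linarith

theorem exists_radius_forall_quadPoly_jet_mem {O : Set (Jet2 n)} (hO : IsOpen O) {m : ℝ}
    {p : EuclideanSpace ℝ (Fin n)} {S : SymMat n} (x₀ : EuclideanSpace ℝ (Fin n))
    (h : -(m, p, S) ∈ O) :
    ∃ κ > 0, ∀ (x : EuclideanSpace ℝ (Fin n)) (a : ℝ) (q : EuclideanSpace ℝ (Fin n)) (e : ℝ),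
      ‖x - x₀‖ ≤ κ → |a| ≤ κ → ‖q‖ ≤ κ → |e| ≤ κ →
      (-quadPoly m p S x₀ x + a, -(p + symCLM S (x - x₀)) - q, -S - e • symOne n) ∈ O := by
  have hQc : Continuous (quadPoly m p S x₀) := (contDiff_quadPoly m p S x₀).continuous
  have hc : Continuous fun z : EuclideanSpace ℝ (Fin n) × ℝ × EuclideanSpace ℝ (Fin n) × ℝ =>
      ((-quadPoly m p S x₀ z.1 + z.2.1, -(p + symCLM S (z.1 - x₀)) - z.2.2.1,
        -S - z.2.2.2 • symOne n) : Jet2 n) := by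
    refine Continuous.prodMk (by fun_prop) (Continuous.prodMk (by fun_prop) ?_)
    exact continuous_const.sub ((continuous_snd.comp (continuous_snd.comp
      continuous_snd)).smul continuous_const)
  have h0 : (-quadPoly m p S x₀ x₀ + 0, -(p + symCLM S (x₀ - x₀)) - 0, -S - (0 : ℝ) • symOne n)
      ∈ O := by
    rw [quadPoly_self, sub_self, map_zero, add_zero, add_zero, sub_zero, zero_smul, sub_zero]
    exact h
  have h1 := (hO.preimage hc).mem_nhds (x := (x₀, 0, 0, 0)) h0
  obtain ⟨κ, hκ, hb⟩ := Metric.nhds_basis_closedBall.mem_iff.1 h1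
  refine ⟨κ, hκ, fun x a q e hx ha hq he => ?_⟩
  have h2 : ((x, a, q, e) : EuclideanSpace ℝ (Fin n) × ℝ × EuclideanSpace ℝ (Fin n) × ℝ)
      ∈ closedBall (x₀, 0, 0, 0) κ := by
    rw [mem_closedBall, dist_eq_norm, Prod.mk_sub_mk, Prod.mk_sub_mk, Prod.mk_sub_mk, sub_zero,
      sub_zero, sub_zero, norm_prod_le_iff, norm_prod_le_iff, norm_prod_le_iff]
    exact ⟨hx, ha, hq, he⟩
  have h3 := hb h2
  rw [mem_preimage] at h3
  exact h3

/-- The theorem on sums in this setting: doubling by sup-convolution yields jets of `u` and `w`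
whose difference lies in `interior M`, against the two viscosity inequalities. -/
theorem not_strict_touching_quadPoly {F M : Set (Jet2 n)} (hF : IsSubequation F)
    (hM : IsMonotonicityConeSubequation M) (hFM : IsMonotoneFor F M) {J₀ : Jet2 n}
    (hJ₀ : J₀ ∈ interior M) {c : ℝ} {u w : EuclideanSpace ℝ (Fin n) → EReal}
    {x₀ : EuclideanSpace ℝ (Fin n)} {R : ℝ} (hR : 0 < R)
    (hu : USC (closedBall x₀ R) u) (hw : LSC (closedBall x₀ R) w)
    (hsub : ∀ x ∈ closedBall x₀ R, ∀ J ∈ upperTestJets u x, c ≤ canonicalOperator F J₀ J)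
    (hsuper : ∀ x ∈ closedBall x₀ R, ∀ J ∈ lowerTestJets w x, canonicalOperator F J₀ J ≤ c)
    {m : ℝ} {p : EuclideanSpace ℝ (Fin n)} {S : SymMat n} (hint : -(m, p, S) ∈ interior M)
    {η : ℝ} (hη : 0 < η)
    (htouch : ∀ x ∈ closedBall x₀ R,
      u x + -w x ≤ ((quadPoly m p S x₀ x - η * ‖x - x₀‖ ^ 2 : ℝ) : EReal))
    (heq : u x₀ + -w x₀ = m) : False := by
  set Q := quadPoly m p S x₀ with hQ
  have hQc : Continuous Q := (contDiff_quadPoly m p S x₀).continuous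
  obtain ⟨κ, hκ, hball⟩ := exists_radius_forall_quadPoly_jet_mem isOpen_interior x₀ hint
  obtain ⟨r, hr, hrR, hrκ⟩ : ∃ r > 0, 3 * r ≤ R ∧ r ≤ κ :=
    ⟨min (R / 3) κ, by positivity, by linarith [min_le_left (R / 3) κ], min_le_right _ _⟩
  set K := closedBall x₀ (3 * r) with hKdef
  have hKR : K ⊆ closedBall x₀ R := closedBall_subset_closedBall hrR
  have hKc : IsCompact K := isCompact_closedBall _ _
  have hx₀K : x₀ ∈ K := mem_closedBall_self (by positivity)
  set v : EuclideanSpace ℝ (Fin n) → EReal := fun x => -w x with hv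
  have hua : UpperSemicontinuousOn u K := hu.1.mono hKR
  have hut : ∀ x ∈ K, u x ≠ ⊤ := fun x hx => hu.2 x (hKR hx)
  have hva : UpperSemicontinuousOn v K :=
    (continuous_neg.comp_lowerSemicontinuousOn_antitone (hw.1.mono hKR)
      fun a b hab => EReal.neg_le_neg_iff.2 hab)
  have hvt : ∀ x ∈ K, v x ≠ ⊤ := fun x hx h => hw.2 x (hKR hx) (EReal.neg_eq_top_iff.1 h)
  have hu0 : u x₀ ≠ ⊥ := fun h => by
    rw [h, EReal.bot_add] at heq; exact EReal.bot_ne_coe _ heq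
  have hv0 : v x₀ ≠ ⊥ := fun h => by
    rw [show -w x₀ = ⊥ from h, EReal.add_bot] at heq; exact EReal.bot_ne_coe _ heq
  have hA : IsCompact (K \ ball x₀ r) := hKc.diff isOpen_ball
  have hlt : ∀ x ∈ K \ ball x₀ r, u x + v x < ((Q x - η / 2 * r ^ 2 : ℝ) : EReal) := by
    rintro x ⟨hxK, hxr⟩
    refine (htouch x (hKR hxK)).trans_lt (EReal.coe_lt_coe_iff.2 ?_)
    rw [mem_ball, dist_eq_norm, not_lt] at hxr
    have : r ^ 2 ≤ ‖x - x₀‖ ^ 2 := by gcongr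
    nlinarith [pow_pos hr 2]
  obtain ⟨L, hL⟩ := exists_penalization hKc hua hut hva hvt hA sdiff_subset
    (g := fun x => Q x - η / 2 * r ^ 2) (by fun_prop) hlt
  obtain ⟨B₁, hB₁⟩ := hua.exists_real_bound hKc hut
  obtain ⟨B₂, hB₂⟩ := hva.exists_real_bound hKc hvt
  obtain ⟨mQ, hmQ⟩ := (hKc.image hQc).bddBelow
  set D := B₁ + B₂ - mQ + κ with hD
  -- `D` bounds both penalties at the contact point, so `D < lam * (2 * r) ^ 2` puts the maximizers
  -- within `2r` of it, hence in the interior of `K`.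
  obtain ⟨lam, hlamL, hlam0, hlamD⟩ : ∃ lam, L ≤ lam ∧ 0 ≤ lam ∧ D < lam * (2 * r) ^ 2 := by
    refine ⟨max L (max 0 ((D + 1) / (2 * r) ^ 2)), le_max_left _ _,
      (le_max_left _ _).trans (le_max_right _ _), ?_⟩
    have h1 : (D + 1) / (2 * r) ^ 2 ≤ max L (max 0 ((D + 1) / (2 * r) ^ 2)) :=
      (le_max_right _ _).trans (le_max_right _ _)
    rw [div_le_iff₀ (by positivity)] at h1
    linarith
  obtain ⟨U, YU, hU⟩ := exists_isSupConvolution hKc hua hut hx₀K hu0 lam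
  obtain ⟨V, YV, hV⟩ := exists_isSupConvolution hKc hva hvt hx₀K hv0 lam
  have hUV0 : Q x₀ ≤ U x₀ + V x₀ := by
    have h1 := add_le_add (hU.apply_le x₀ x₀ hx₀K) (hV.apply_le x₀ x₀ hx₀K)
    simp only [sub_self, norm_zero, ne_eq, OfNat.ofNat_ne_zero, not_false_eq_true, zero_pow,
      mul_zero, add_zero] at h1
    rw [show u x₀ + v x₀ = m from heq, ← EReal.coe_add, EReal.coe_le_coe_iff] at h1
    rwa [hQ, quadPoly_self]
  have hann : ∀ x, r ≤ ‖x - x₀‖ → ‖x - x₀‖ ≤ 3 * r → U x + V x ≤ Q x - η / 2 * r ^ 2 := by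
    intro x h1 h2
    have := hL lam hlamL x ⟨by rwa [hKdef, mem_closedBall, dist_eq_norm],
      by rwa [mem_ball, dist_eq_norm, not_lt]⟩ _ (hU.mem x) _ (hV.mem x) _ _ (hU.apply_eq x)
      (hV.apply_eq x)
    linarith
  obtain ⟨x, q, A, B, hxr, hqκ, hsum, hval, hPU, hPV, hAB⟩ :=
    exists_contact_point hr hlam0 hU.hasLowerParaboloids hV.hasLowerParaboloids
      (quadPoly_expand m p S x₀) (hU.continuous hlam0 hKc.isBounded)
      (hV.continuous hlam0 hKc.isBounded) hUV0 (by positivity) hann hκ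
  have hxK : x ∈ K := by rw [hKdef, mem_closedBall, dist_eq_norm]; linarith
  have hQx : mQ ≤ Q x := hmQ (mem_image_of_mem Q hxK)
  have hu1 := hB₁ _ (hU.mem x)
  have hv1 := hB₂ _ (hV.mem x)
  rw [hU.apply_eq, EReal.coe_le_coe_iff] at hu1
  rw [hV.apply_eq, EReal.coe_le_coe_iff] at hv1
  have sU : 0 ≤ lam * ‖x - YU x‖ ^ 2 := by positivity
  have sV : 0 ≤ lam * ‖x - YV x‖ ^ 2 := by positivity
  have hnear : ∀ y, lam * ‖x - y‖ ^ 2 ≤ D → K ∈ 𝓝 y := by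
    intro y hy
    have h1 : ‖x - y‖ < 2 * r := by
      have h2 := hy.trans_lt hlamD
      by_contra h3
      have h4 : (2 * r) ^ 2 ≤ ‖x - y‖ ^ 2 := by gcongr; exact not_lt.1 h3
      nlinarith
    refine Filter.mem_of_superset (isOpen_ball.mem_nhds (?_ : y ∈ ball x₀ (3 * r)))
      ball_subset_closedBall
    rw [mem_ball, dist_eq_norm]
    have e : y - x₀ = (x - x₀) - (x - y) := by abel
    rw [e]
    exact (norm_sub_le _ _).trans_lt (by linarith)
  obtain ⟨SA, hSA⟩ := exists_symCLM_inner_self A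
  obtain ⟨SB, hSB⟩ := exists_symCLM_inner_self B
  have hJ1 := mem_upperTestJets_of_hasPeanoExpansionAt (half_pos hκ)
    (hnear _ (by linarith)) (hU.apply_eq x) hU.apply_le hPU hSA
  have hJ2 := neg_mem_lowerTestJets (mem_upperTestJets_of_hasPeanoExpansionAt (half_pos hκ)
    (hnear _ (by linarith)) (hV.apply_eq x) hV.apply_le hPV hSB)
  have h1 := hsub _ (hKR (hU.mem x)) _ hJ1
  have h2 := hsuper _ (hKR (hV.mem x)) _ hJ2
  have hin := hball x κ q κ (hxr.trans hrκ) (abs_of_pos hκ).le hqκ (abs_of_pos hκ).le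
  -- This corrects the perturbed jet of `-Q` to the exact sums of values and Hessians; the signs
  -- come from the lower bound on `U + V` and from `hAB`.
  have hmin := hM.minimal_subset
    (Q x - κ - (U x + lam * ‖x - YU x‖ ^ 2) - (V x + lam * ‖x - YV x‖ ^ 2)) (S - SA - SB)
    (by linarith) (posSemidef_of_inner_symCLM_nonneg fun e => by
      rw [symCLM_sub, symCLM_sub, _root_.sub_apply, _root_.sub_apply, inner_sub_left, inner_sub_left, hSA, hSB]
      linarith [hAB e])
  have h3 := canonicalOperator_lt_add hF hM hFM hJ₀
    (U x + lam * ‖x - YU x‖ ^ 2, (-2 * lam) • (x - YU x), SA + (κ / 2) • symOne n)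
    (hM.add_mem_interior hin hmin)
  refine absurd (h3.trans_le (le_of_eq_of_le (congrArg _ ?_) h2)) (not_lt.2 h1)
  refine Prod.ext ?_ (Prod.ext ?_ ?_)
  · simp only [Prod.fst_add, Prod.fst_neg]; ring
  · simp only [Prod.snd_add, Prod.fst_add, Prod.snd_neg, Prod.fst_neg, add_zero]
    rw [← sub_eq_iff_eq_add.2 hsum.symm]
    abel
  · simp only [Prod.snd_add, Prod.snd_neg]
    have h4 : κ • symOne n = (κ / 2) • symOne n + (κ / 2) • symOne n := by
      rw [← add_smul, add_halves]
    rw [h4]; abel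

end Comparison

/-! ### From the strict approximator to strict quadratic touching. -/

section Comparison

variable {n : ℕ}

theorem IsMonotonicityConeSubequation.exists_sub_smul_symOne_mem_interior {M : Set (Jet2 n)}
    (hM : IsMonotonicityConeSubequation M) {J : Jet2 n} (hJ : J ∈ interior M) {s : ℝ}
    (hs : s ≤ J.1) : ∃ η : ℝ, 0 < η ∧ (s, J.2.1, J.2.2 - (4 * η) • symOne n) ∈ interior M := by
  obtain ⟨r, p, S⟩ := J
  have hc : Continuous fun η : ℝ => ((r, p, S - (4 * η) • symOne n) : Jet2 n) := by
    refine continuous_const.prodMk (continuous_const.prodMk (continuous_const.sub ?_))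
    exact (continuous_const.mul continuous_id).smul continuous_const
  have h0 : (r, p, S - (4 * (0 : ℝ)) • symOne n) ∈ interior M := by
    rw [mul_zero, zero_smul, sub_zero]; exact hJ
  have h1 : ∀ᶠ η in 𝓝[>] (0 : ℝ), (r, p, S - (4 * η) • symOne n) ∈ interior M :=
    nhdsWithin_le_nhds ((isOpen_interior.preimage hc).mem_nhds h0)
  obtain ⟨η, h2, hη⟩ := (h1.and self_mem_nhdsWithin).exists
  refine ⟨η, hη, ?_⟩
  have h3 := hM.add_mem_interior h2
    (hM.minimal_subset (s - r) 0 (sub_nonpos.2 hs) Matrix.PosSemidef.zero)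
  rwa [Prod.mk_add_mk, Prod.mk_add_mk, add_zero, add_zero, add_sub_cancel] at h3

theorem not_touching_neg_approximator {F M : Set (Jet2 n)} (hF : IsSubequation F)
    (hM : IsMonotonicityConeSubequation M) (hFM : IsMonotoneFor F M) {J₀ : Jet2 n}
    (hJ₀ : J₀ ∈ interior M) {c : ℝ} {u w : EuclideanSpace ℝ (Fin n) → EReal}
    {Ω : Set (EuclideanSpace ℝ (Fin n))} (hΩ : IsOpen Ω)
    (hsub : IsViscositySubsolution (canonicalOperator F J₀) c Ω u)
    (hsuper : IsViscositySupersolution (canonicalOperator F J₀) c Ω w)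
    {ψ : EuclideanSpace ℝ (Fin n) → ℝ} {x₀ : EuclideanSpace ℝ (Fin n)} (hx₀ : x₀ ∈ Ω)
    (hψ : ContDiffAt ℝ 2 ψ x₀) {J : Jet2 n} (hJ : J ∈ interior M) (hψJ : IsJetAt ψ x₀ J)
    {m ε : ℝ} (hε : 0 < ε) (hm : 0 ≤ m + ε * ψ x₀) (heq : u x₀ + -w x₀ = m)
    (hle : ∀ x ∈ Ω, u x + -w x ≤ ((m + ε * (ψ x₀ - ψ x) : ℝ) : EReal)) : False := by
  obtain ⟨η, hη, hint⟩ := hM.exists_sub_smul_symOne_mem_interior (s := -m)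
    (hM.smul_mem_interior hJ hε) (by rw [Prod.smul_fst, hψJ.1, smul_eq_mul]; linarith)
  -- The Hessian shift `4η` contributes `2η‖x - x₀‖²`; the Peano error of `εψ` uses up one `η`, and
  -- the other remains as strictness.
  have hP := hψJ.hasPeanoExpansionAt hψ (η / ε) (by positivity)
  obtain ⟨R, hR, hball⟩ := Metric.nhds_basis_closedBall.mem_iff.1
    (Filter.inter_mem hP (hΩ.mem_nhds hx₀))
  have hRΩ : closedBall x₀ R ⊆ Ω := fun x hx => (hball hx).2
  refine not_strict_touching_quadPoly hF hM hFM hJ₀ (c := c) hR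
    ⟨hsub.1.1.mono hRΩ, fun x hx => hsub.1.2 x (hRΩ hx)⟩
    ⟨hsuper.1.1.mono hRΩ, fun x hx => hsuper.1.2 x (hRΩ hx)⟩
    (fun x hx => hsub.2 x (hRΩ hx)) (fun x hx => hsuper.2 x (hRΩ hx))
    (p := -(ε • J.2.1)) (S := -(ε • J.2.2 - (4 * η) • symOne n)) ?_ hη (fun x hx => ?_) heq
  · rw [Prod.neg_mk, Prod.neg_mk, neg_neg, neg_neg]; exact hint
  · refine (hle x (hRΩ hx)).trans (EReal.coe_le_coe_iff.2 ?_)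
    have h0 : |ψ x - ψ x₀ - ⟪J.2.1, x - x₀⟫ - 1 / 2 * ⟪symCLM J.2.2 (x - x₀), x - x₀⟫|
        ≤ η / ε * ‖x - x₀‖ ^ 2 := (hball hx).1
    have h1 := (abs_le.1 h0).1
    have h2 := mul_le_mul_of_nonneg_left h1 hε.le
    have h3 : ε * -(η / ε * ‖x - x₀‖ ^ 2) = -(η * ‖x - x₀‖ ^ 2) := by field_simp
    rw [h3] at h2
    have h4 : symCLM (-(ε • J.2.2 - (4 * η) • symOne n))
        = (4 * η) • (1 : EuclideanSpace ℝ (Fin n) →L[ℝ] EuclideanSpace ℝ (Fin n))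
          - ε • symCLM J.2.2 := by
      rw [neg_sub, symCLM_sub, symCLM_smul, symCLM_smul, symCLM_symOne]
    rw [quadPoly, h4, _root_.sub_apply, _root_.smul_apply, _root_.smul_apply, one_apply_eq_self,
      inner_sub_left, real_inner_smul_left, real_inner_smul_left, real_inner_self_eq_norm_sq,
      inner_neg_left, real_inner_smul_left]
    linarith

end Comparison

/-! ### The comparison principle. -/

theorem mainTheorem8 (n : ℕ) (F M : Set (Jet2 n)) (hF : IsSubequation F)
    (hM : IsMonotonicityConeSubequation M) (hFM : IsMonotoneFor F M)
    (Ω : Set (EuclideanSpace ℝ (Fin n))) (hΩ : IsOpen Ω) (hΩb : Bornology.IsBounded Ω)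
    (hψ : AdmitsStrictApproximator M Ω) (J₀ : Jet2 n) (hJ₀ : J₀ ∈ interior M) (c : ℝ)
    (u w : EuclideanSpace ℝ (Fin n) → EReal)
    (hu : USC (closure Ω) u) (hw : LSC (closure Ω) w)
    (hsub : IsViscositySubsolution (canonicalOperator F J₀) c Ω u)
    (hsuper : IsViscositySupersolution (canonicalOperator F J₀) c Ω w)
    (hbd : ∀ x ∈ frontier Ω, u x ≤ w x) :
    ∀ x ∈ Ω, u x ≤ w x := by
  intro x₁ hx₁
  by_contra hlt
  rw [not_le] at hlt
  obtain ⟨ψ, hψc, hψ2, hψJ⟩ := hψ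
  have hK : IsCompact (closure Ω) := hΩb.isCompact_closure
  have hx₁K : x₁ ∈ closure Ω := subset_closure hx₁
  obtain ⟨a, ha1, ha2⟩ := EReal.lt_iff_exists_real_btwn.1 hlt
  obtain ⟨b, hb1, hb2⟩ := EReal.lt_iff_exists_real_btwn.1 ha2
  have hab : a < b := EReal.coe_lt_coe_iff.1 hb1
  have hz₁ : ((b - a : ℝ) : EReal) ≤ u x₁ + -w x₁ := by
    rw [sub_eq_add_neg, EReal.coe_add, EReal.coe_neg]
    exact add_le_add hb2.le (EReal.neg_le_neg_iff.2 ha1.le)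
  obtain ⟨B, hB⟩ := hK.exists_bound_of_continuousOn hψc
  have hB0 : 0 ≤ B := (norm_nonneg _).trans (hB x₁ hx₁K)
  -- With `|ψ| ≤ B`, a boundary maximum would give `b - a ≤ 2εB`; the same smallness gives `0 ≤ m +
  -- ε ψ x₀`.
  obtain ⟨ε, hε, hεB⟩ : ∃ ε > 0, 2 * (ε * B) < b - a := by
    have hba : 0 < b - a := sub_pos.2 hab
    refine ⟨(b - a) / (2 * B + 1), by positivity, ?_⟩
    have h1 : 2 * ((b - a) / (2 * B + 1) * B) = (b - a) * (2 * B) / (2 * B + 1) := by ring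
    rw [h1, div_lt_iff₀ (by positivity)]
    linarith
  have hψB : ∀ x ∈ closure Ω, |ε * ψ x| ≤ ε * B := fun x hx => by
    rw [abs_mul, abs_of_pos hε]
    exact mul_le_mul_of_nonneg_left (hB x hx) hε.le
  have hwn : UpperSemicontinuousOn (fun x => -w x) (closure Ω) :=
    continuous_neg.comp_lowerSemicontinuousOn_antitone hw.1
      fun a b hab => EReal.neg_le_neg_iff.2 hab
  have hwt : ∀ x ∈ closure Ω, -w x ≠ ⊤ := fun x hx h => hw.2 x hx (EReal.neg_eq_top_iff.1 h)
  have hz : UpperSemicontinuousOn (fun x => u x + -w x) (closure Ω) :=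
    hu.1.add' hwn fun x hx =>
      EReal.continuousAt_add (Or.inl (hu.2 x hx)) (Or.inr (hwt x hx))
  have hzψ : UpperSemicontinuousOn (fun x => u x + -w x + ((ε * ψ x : ℝ) : EReal))
      (closure Ω) := by
    refine hz.add' (ContinuousOn.upperSemicontinuousOn ?_) fun x _ =>
      EReal.continuousAt_add (Or.inr (EReal.coe_ne_bot _)) (Or.inr (EReal.coe_ne_top _))
    exact continuous_coe_real_ereal.comp_continuousOn (continuousOn_const.mul hψc)
  obtain ⟨x₀, hx₀K, hmax⟩ := hzψ.exists_isMaxOn ⟨x₁, hx₁K⟩ hK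
  have hmax : ∀ x ∈ closure Ω, u x + -w x + ((ε * ψ x : ℝ) : EReal)
      ≤ u x₀ + -w x₀ + ((ε * ψ x₀ : ℝ) : EReal) := fun x hx => hmax hx
  have hlow : ((b - a + ε * ψ x₁ : ℝ) : EReal) ≤ u x₀ + -w x₀ + ((ε * ψ x₀ : ℝ) : EReal) := by
    rw [EReal.coe_add]
    exact (add_le_add hz₁ le_rfl).trans (hmax x₁ hx₁K)
  have hψ₁ := (abs_le.1 (hψB x₁ hx₁K)).1
  have hψ₀ := (abs_le.1 (hψB x₀ hx₀K)).2
  have hbot : u x₀ + -w x₀ ≠ ⊥ := fun h => by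
    rw [h, EReal.bot_add, le_bot_iff] at hlow
    exact EReal.coe_ne_bot _ hlow
  have htop : u x₀ + -w x₀ ≠ ⊤ := EReal.add_ne_top (hu.2 x₀ hx₀K) (hwt x₀ hx₀K)
  obtain ⟨m, hm⟩ : ∃ m : ℝ, u x₀ + -w x₀ = m := ⟨_, (EReal.coe_toReal htop hbot).symm⟩
  rw [hm, ← EReal.coe_add, EReal.coe_le_coe_iff] at hlow
  have hx₀ : x₀ ∈ Ω := by
    by_contra hn
    have h1 := hbd x₀ (by rw [hΩ.frontier_eq]; exact ⟨hx₀K, hn⟩)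
    have h2 : u x₀ + -w x₀ ≤ 0 := by
      rw [← sub_eq_add_neg]
      exact EReal.sub_nonpos.2 h1
    rw [hm, ← EReal.coe_zero, EReal.coe_le_coe_iff] at h2
    linarith
  obtain ⟨J, hJ, hψJ⟩ := hψJ x₀ hx₀
  refine not_touching_neg_approximator hF hM hFM hJ₀ hΩ hsub hsuper hx₀
    (hψ2.contDiffAt (hΩ.mem_nhds hx₀)) hJ hψJ hε (by linarith) hm fun x hx => ?_
  have h1 := hmax x (subset_closure hx)
  rw [hm, ← EReal.coe_add] at h1
  have h2 := EReal.le_sub_iff_add_le (a := u x + -w x) (b := ((ε * ψ x : ℝ) : EReal))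
    (c := ((m + ε * ψ x₀ : ℝ) : EReal)) (Or.inl (EReal.coe_ne_bot _))
    (Or.inl (EReal.coe_ne_top _))
  refine (h2.2 h1).trans (le_of_eq ?_)
  rw [← EReal.coe_sub]; congr 1; ring
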